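/- Let $\Sigma=\{0,1\}$ and let $\Sigma^*=\bigcup_{m\ge 1}\Sigma^m$ be the set of non-empty finite words over $\Sigma$. A promise problem is a function $\phi$ that assigns to each $x\in\Sigma^*$ a non-empty subset $\phi(x)\subseteq\Sigma$ of valid answers; a function $\phi:\Sigma^*\to\Sigma$ is regarded as the promise problem $x\mapsto\{\phi(x)\}$. For promise problems, $\phi_1\propto\phi_2$ means that there is a polynomial-time computable $\mu:\Sigma^*\to\Sigma^*$ with $\phi_1(x)\supseteq\phi_2(\mu(x))$ for all $x$, and $[\phi_2]=\{\phi_1\mid\phi_1\propto\phi_2\}$. Further, $\phi_1\propto_T\phi_2$ means that there are a $\phi_2$-oracle Turing machine $M$ and a polynomial $p$ such that on every input $x\in\Sigma^*$ every possible path of $M$ halts within $p(|x|)$ steps and outputs an element of $\phi_1(x)$; here a query $w\in\Sigma^*$ takes one step and may be answered by any element of $\phi_2(w)$, independently of earlier answers. Put $\widehat{\mathrm P}^{\phi_2}=\{\phi_1\mid\phi_1\propto_T\phi_2\}$ and, for a class $X$ of promise problems, $\widehat{\mathrm P}^{X}=\bigcup_{\phi\in X}\widehat{\mathrm P}^{\phi}$.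 For $n\ge 1$, consider functions $f:\Sigma^{m_1}\times\cdots\times\Sigma^{m_n}\to\Sigma$ with $m_1,\dots,m_n\ge 1$, given (encoded as words) by $m_1,\dots,m_n$ in unary and a Boolean expression with the operators $\land,\lor,\lnot$. For $x\in\Sigma^{m_1}$ let $f_x$ be the function of the remaining $n-1$ arguments obtained by fixing the first argument to be $x$. Define $\mathrm{SAT}_n(f)=1$ iff $\exists x:\overline{\mathrm{SAT}}_{n-1}(f_x)=1$, and $\overline{\mathrm{SAT}}_n(f)=1$ iff $\forall x:\mathrm{SAT}_{n-1}(f_x)=1$, where for $n=0$ both are the value of $f$. Let $\mathrm{VAL}_n(f)$ be the set of the first letters $x_1$ of all $x\in\Sigma^{m_1}$ with $\overline{\mathrm{SAT}}_{n-1}(f_x)=1$ if $\mathrm{SAT}_n(f)=1$, and $\Sigma$ otherwise. On words that encode no such $f$, the value of $\mathrm{SAT}_n$ is $0$ and that of $\mathrm{VAL}_n$ is $\Sigma$. Put $\widehat{\mathrm V}_n=[\mathrm{VAL}_n]$ and $\widehat\Delta_{n+1}=\widehat{\mathrm P}^{\mathrm{SAT}_n}$. Theorem. For every $n\ge 1$,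 $\widehat{\mathrm P}^{\widehat{\mathrm V}_n}=\widehat\Delta_{n+1}$, and also $\widehat{\mathrm P}^{\mathrm{VAL}_n}=\widehat\Delta_{n+1}$. -/

import Mathlib

namespace PromiseHierarchy

/-! ### Words and promise problems -/

/-- `Σ*`: the non-empty finite words over the alphabet `{0,1}`. -/
abbrev Word : Type := {w : List Bool // w ≠ []}

/-- `P₊Σ`: the non-empty subsets of `{0,1}`. -/
abbrev PPlus : Type := {S : Set Bool // S.Nonempty}

/-- A (non-promise) problem `Σ* → Σ`. -/
abbrev Problem : Type := Word → Bool

/-- A promise problem `Σ* → P₊Σ`: to each word the set of its valid answers. -/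
abbrev PromiseProblem : Type := Word → PPlus

/-- A problem `φ` regarded as the promise problem `x ↦ {φ x}`. -/
def Problem.toPromise (φ : Problem) : PromiseProblem :=
  fun x => ⟨{φ x}, Set.singleton_nonempty _⟩

/-! ### Strong (many-one, Karp) reduction -/

/-- `φ₁ ∝ φ₂`: some polynomial-time computable `μ : Σ* → Σ*` has `φ₁ x ⊇ φ₂ (μ x)` for all `x`. -/
def StrongReduces (φ₁ φ₂ : PromiseProblem) : Prop :=
  ∃ μ : Word → Word,
    Nonempty (Turing.TM2ComputableInPolyTime
      (Subtype.val : Word → List Bool) (Subtype.val : Word → List Bool) μ) ∧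
    ∀ x : Word, (φ₂ (μ x) : Set Bool) ⊆ (φ₁ x : Set Bool)

/-- The strong closure `[φ₂] = {φ₁ | φ₁ ∝ φ₂}`. -/
def strongClosure (φ₂ : PromiseProblem) : Set PromiseProblem :=
  {φ₁ | StrongReduces φ₁ φ₂}

/-! ### Oracle Turing machines and weak (Turing, Cook) reduction -/

/-- An oracle Turing machine with input and output words over `{0,1}`: a Turing machine of the
kind that `Turing.TM2ComputableInPolyTime` is about, with one of its stacks serving as the query
stack, and with some of its labels being query labels. At a label `l` with `query l = some next`
the machine hands the word on the query stack to the oracle (the first letter of the word on top),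
receives an answer `b`, and continues at the label `next b` with the query stack emptied;
at a label `l` with `query l = none` it executes its statement `tm.m l`. -/
structure OracleTM extends Turing.TM2ComputableAux Bool Bool where
  /-- the stack from which the oracle reads the query -/
  queryStack : tm.K
  /-- the alphabet of the query stack is `{0,1}` -/
  queryAlphabet : tm.Γ queryStack ≃ Bool
  /-- the query labels, with the labels at which the machine continues after an answer -/
  query : tm.Λ → Option (Bool → tm.Λ)

namespace OracleTM

/-- One step of `M` with an oracle for the promise problem `φ`. A query of `w` takes unit time and
may be answered by any element of `φ w`, independently of earlier answers. There is no step from a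
query label when the query stack is empty, because the empty word is not in `Σ*`. -/
inductive Step (M : OracleTM) (φ : PromiseProblem) : M.tm.Cfg → M.tm.Cfg → Prop
  | compute (l : M.tm.Λ) (v : M.tm.σ) (S : ∀ k, List (M.tm.Γ k)) (h : M.query l = none) :
      Step M φ ⟨some l, v, S⟩ (Turing.TM2.stepAux (M.tm.m l) v S)
  | ask (l : M.tm.Λ) (v : M.tm.σ) (S : ∀ k, List (M.tm.Γ k)) (next : Bool → M.tm.Λ)
      (w : Word) (b : Bool) (h : M.query l = some next)
      (hw : (S M.queryStack).map M.queryAlphabet = w.1) (hb : b ∈ (φ w : Set Bool)) :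
      Step M φ ⟨some l, v, S⟩ ⟨some (next b), v, Function.update S M.queryStack []⟩

/-- The initial configuration on input `x`. -/
def init (M : OracleTM) (x : Word) : M.tm.Cfg :=
  Turing.initList M.tm (x.1.map M.inputAlphabet.symm)

/-- The halting configuration with output `b`. -/
def halted (M : OracleTM) (b : Bool) : M.tm.Cfg :=
  Turing.haltList M.tm [M.outputAlphabet.symm b]

/-- `M.AllPaths φ A t c`: every possible path of `M` with an oracle for `φ`, starting from the
configuration `c`, halts within `t` steps with an output that belongs to `A`. -/
inductive AllPaths (M : OracleTM) (φ : PromiseProblem) (A : Set Bool) : ℕ → M.tm.Cfg → Prop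
  | halt (t : ℕ) (c : M.tm.Cfg) (b : Bool) (hb : b ∈ A) (hc : c = M.halted b) :
      AllPaths M φ A t c
  | step (t : ℕ) (c : M.tm.Cfg) (hex : ∃ c', M.Step φ c c')
      (hall : ∀ c', M.Step φ c c' → AllPaths M φ A t c') : AllPaths M φ A (t + 1) c

end OracleTM

/-- `φ₁ ∝_T φ₂`: there are a `φ₂`-oracle Turing machine `M` and a polynomial `p` such that on every
input `x` every possible path of `M` runs in time at most `p(|x|)` and computes some element of
`φ₁ x`. -/
def WeakReduces (φ₁ φ₂ : PromiseProblem) : Prop :=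
  ∃ (M : OracleTM) (p : Polynomial ℕ), ∀ x : Word,
    M.AllPaths φ₂ (φ₁ x : Set Bool) (p.eval x.1.length) (M.init x)

/-- The weak closure `P̂^φ₂ = {φ₁ | φ₁ ∝_T φ₂}` of a promise problem. -/
def weakClosure (φ₂ : PromiseProblem) : Set PromiseProblem :=
  {φ₁ | WeakReduces φ₁ φ₂}

/-- `P̂^X` for a class `X` of promise problems: everything that is Turing reducible to a problem
in `X`. -/
def weakClosureOfClass (X : Set PromiseProblem) : Set PromiseProblem :=
  {φ₁ | ∃ φ₂ ∈ X, WeakReduces φ₁ φ₂}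

/-! ### Boolean expressions and their encoding -/

/-- Boolean expressions; `var i j` is the `j`-th variable of the `i`-th block (counting from 0). -/
inductive BoolExpr : Type
  | var (i j : ℕ) : BoolExpr
  | neg (f : BoolExpr) : BoolExpr
  | and (f g : BoolExpr) : BoolExpr
  | or (f g : BoolExpr) : BoolExpr

namespace BoolExpr

/-- All variables of the expression belong to blocks of the sizes `ms`. -/
def WellFormed (ms : List ℕ) : BoolExpr → Prop
  | var i j => j < ms.getD i 0
  | neg f => f.WellFormed ms
  | and f g => f.WellFormed ms ∧ g.WellFormed ms
  | or f g => f.WellFormed ms ∧ g.WellFormed ms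

/-- The value when the `i`-th entry of `ys` is the word assigned to the `i`-th block. -/
def eval (ys : List (List Bool)) : BoolExpr → Bool
  | var i j => (ys.getD i []).getD j false
  | neg f => !f.eval ys
  | and f g => f.eval ys && g.eval ys
  | or f g => f.eval ys || g.eval ys

end BoolExpr

/-- The unary encoding `1^k 0` of `k`. -/
def unary (k : ℕ) : List Bool := List.replicate k true ++ [false]

/-- The encoding of a Boolean expression as a word: prefix (Polish) notation with the tokens `00`
for `¬`, `01` for `∧`, `10` for `∨`, and `11` followed by the two indices for a variable. -/
def BoolExpr.encode : BoolExpr → List Bool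
  | var i j => true :: true :: (unary i ++ unary j)
  | neg f => false :: false :: f.encode
  | and f g => false :: true :: (f.encode ++ g.encode)
  | or f g => true :: false :: (f.encode ++ g.encode)

/-- A function `f : Σ^{m₁} × ⋯ × Σ^{mₙ} → Σ`, given by its block sizes `m₁, …, mₙ ≥ 1` and a Boolean
expression in the `m₁ + ⋯ + mₙ` variables. -/
structure Instance (n : ℕ) where
  /-- the block sizes `m₁, …, mₙ` -/
  sizes : List ℕ
  /-- the Boolean expression -/
  expr : BoolExpr
  length_sizes : sizes.length = n
  one_le_sizes : ∀ m ∈ sizes, 1 ≤ m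
  wellFormed : expr.WellFormed sizes

namespace Instance

/-- The encoding of a function as a word: the block sizes, then the Boolean expression. -/
def encode {n : ℕ} (I : Instance n) : List Bool :=
  I.sizes.flatMap unary ++ I.expr.encode

/-- The function itself, on the lists `[x, y⁽¹⁾, …, y⁽ⁿ⁻¹⁾]` of words of lengths `m₁, …, mₙ`. -/
def fn {n : ℕ} (I : Instance n) : List (List Bool) → Bool :=
  fun ys => I.expr.eval ys

end Instance

/-! ### The encoding is unambiguous -/

theorem unary_append_inj {k l : ℕ} {r s : List Bool} (h : unary k ++ r = unary l ++ s) :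
    k = l ∧ r = s := by
  induction k generalizing l with
  | zero => cases l <;> simp_all [unary, List.replicate_succ]
  | succ k ih =>
    cases l with
    | zero => simp [unary, List.replicate_succ] at h
    | succ l =>
      have h' : unary k ++ r = unary l ++ s := by
        simpa [unary, List.replicate_succ] using h
      have := ih h'
      exact ⟨by rw [this.1], this.2⟩

theorem BoolExpr.encode_append_inj (f g : BoolExpr) {r s : List Bool}
    (h : f.encode ++ r = g.encode ++ s) : f = g ∧ r = s := by
  induction f generalizing g r s with
  | var i j =>
    cases g <;> simp [BoolExpr.encode] at h
    have h₁ := unary_append_inj h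
    have h₂ := unary_append_inj h₁.2
    exact ⟨by rw [h₁.1, h₂.1], h₂.2⟩
  | neg f ih =>
    cases g <;> simp [BoolExpr.encode] at h
    have h₁ := ih _ h
    exact ⟨by rw [h₁.1], h₁.2⟩
  | and f₁ f₂ ih₁ ih₂ =>
    cases g <;> simp [BoolExpr.encode] at h
    have h₁ := ih₁ _ h
    have h₂ := ih₂ _ h₁.2
    exact ⟨by rw [h₁.1, h₂.1], h₂.2⟩
  | or f₁ f₂ ih₁ ih₂ =>
    cases g <;> simp [BoolExpr.encode] at h
    have h₁ := ih₁ _ h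
    have h₂ := ih₂ _ h₁.2
    exact ⟨by rw [h₁.1, h₂.1], h₂.2⟩

theorem flatMap_unary_append_inj {ms ls : List ℕ} (hlen : ms.length = ls.length)
    {r s : List Bool} (h : ms.flatMap unary ++ r = ls.flatMap unary ++ s) : ms = ls ∧ r = s := by
  induction ms generalizing ls with
  | nil => cases ls <;> simp_all
  | cons m ms ih =>
    cases ls with
    | nil => simp at hlen
    | cons l ls =>
      simp only [List.flatMap_cons, List.append_assoc] at h
      have h₁ := unary_append_inj h
      have h₂ := ih (by simpa using hlen) h₁.2
      exact ⟨by rw [h₁.1, h₂.1], h₂.2⟩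

/-- A word encodes at most one function. -/
theorem Instance.encode_injective {n : ℕ} :
    Function.Injective (Instance.encode : Instance n → List Bool) := by
  rintro ⟨ms, f, hm, _, _⟩ ⟨ls, g, hl, _, _⟩ h
  have h₁ := flatMap_unary_append_inj (hm.trans hl.symm) h
  have h₂ := BoolExpr.encode_append_inj f g (r := []) (s := []) (by simpa using h₁.2)
  obtain rfl := h₁.1
  obtain rfl := h₂.1
  rfl

/-! ### The problems `SATₙ` and `VALₙ` -/

mutual

/-- `Sat [m₁, …, mₙ] f`, that is, `SATₙ(f) = 1`, for `f` on `Σ^{m₁} × ⋯ × Σ^{mₙ}`: there is `x` with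
`coSATₙ₋₁(f_x) = 1`. -/
def Sat : List ℕ → (List (List Bool) → Bool) → Prop
  | [], f => f [] = true
  | m :: ms, f => ∃ x : List Bool, x.length = m ∧ CoSat ms (fun ys => f (x :: ys))

/-- `CoSat [m₁, …, mₙ] f`, that is, `coSATₙ(f) = 1`: all `x` have `SATₙ₋₁(f_x) = 1`. -/
def CoSat : List ℕ → (List (List Bool) → Bool) → Prop
  | [], f => f [] = true
  | m :: ms, f => ∀ x : List Bool, x.length = m → Sat ms (fun ys => f (x :: ys))

end

/-- The set `{x | coSATₙ₋₁(f_x) = 1}` of the words `x ∈ Σ^{m₁}` that witness `SATₙ(f) = 1`. -/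
def witnesses : List ℕ → (List (List Bool) → Bool) → Set (List Bool)
  | [], _ => ∅
  | m :: ms, f => {x | x.length = m ∧ CoSat ms (fun ys => f (x :: ys))}

/-- `{π₁ x | coSATₙ₋₁(f_x) = 1}`. -/
def firstBits (ms : List ℕ) (f : List (List Bool) → Bool) : Set Bool :=
  {b | ∃ x ∈ witnesses ms f, x.head? = some b}

theorem firstBits_nonempty {n : ℕ} (I : Instance n) (hn : n ≠ 0) (h : Sat I.sizes I.fn) :
    (firstBits I.sizes I.fn).Nonempty := by
  obtain ⟨ms, f, hl, h1, hw⟩ := I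
  cases ms with
  | nil => exact absurd hl.symm hn
  | cons m ms =>
    simp only [Sat] at h
    obtain ⟨x, hx, hc⟩ := h
    cases x with
    | nil =>
      have := h1 m (by simp)
      simp at hx
      omega
    | cons b x => exact ⟨b, b :: x, ⟨hx, hc⟩, rfl⟩

open Classical in
/-- The value `VALₙ(f)`: it is `{π₁ x | coSATₙ₋₁(f_x) = 1}` if `SATₙ(f) = 1`, and `Σ` otherwise.
(Without blocks there is no `x`; the convention there is `Σ`.) -/
noncomputable def Instance.val {n : ℕ} (I : Instance n) : PPlus :=
  if h : n ≠ 0 ∧ Sat I.sizes I.fn then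
    ⟨firstBits I.sizes I.fn, firstBits_nonempty I h.1 h.2⟩
  else ⟨Set.univ, Set.univ_nonempty⟩

open Classical in
/-- The non-promise problem `SATₙ`; a word that encodes no function has the answer `0`. -/
noncomputable def SAT (n : ℕ) : Problem :=
  fun w => decide (∃ I : Instance n, I.encode = w.1 ∧ Sat I.sizes I.fn)

open Classical in
/-- The promise problem `VALₙ`; for a word that encodes no function both answers are valid. -/
noncomputable def VAL (n : ℕ) : PromiseProblem :=
  fun w => if h : ∃ I : Instance n, I.encode = w.1 then h.choose.val
    else ⟨Set.univ, Set.univ_nonempty⟩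

/-- `VALₙ` on the encoding of a function is the value at that function. -/
theorem VAL_encode {n : ℕ} (I : Instance n) (w : Word) (h : I.encode = w.1) :
    VAL n w = I.val := by
  have hex : ∃ J : Instance n, J.encode = w.1 := ⟨I, h⟩
  have : hex.choose = I := Instance.encode_injective (hex.choose_spec.trans h.symm)
  rw [VAL, dif_pos hex, this]

/-! ### The classes -/

/-- `V̂ₙ = [VALₙ]`. -/
noncomputable def VHat (n : ℕ) : Set PromiseProblem := strongClosure (VAL n)

/-- `Δ̂ₖ = P̂^{SATₖ₋₁}` (for `k ≥ 2`), that is, `Δ̂ₙ₊₁ = P̂^{SATₙ}` for `n ≥ 1`. -/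
noncomputable def DeltaHat (k : ℕ) : Set PromiseProblem := weakClosure (SAT (k - 1)).toPromise

end PromiseHierarchy

open PromiseHierarchy

namespace PromiseHierarchy

open Turing

-- Turing reducibility is transitive (`WeakReduces.trans`), so the closures of SATₙ and VALₙ agree
-- once each problem reduces to the other. Passing from VALₙ to the class V̂ₙ adds nothing: a
-- many-one reduction is a Turing reduction with a single query (`StrongReduces.weakReduces`), and
-- VALₙ itself lies in V̂ₙ.
--
-- VALₙ reduces to SATₙ by one query: ask whether f has a witness whose first letter is 1, that is,
-- whether x₁ ∧ f is in SATₙ, and return the answer. If it is 1, some witness starts with 1. If it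
-- is 0, either f has no witness and every answer is valid, or all witnesses start with 0
-- (`Instance.mem_val`).
--
-- SATₙ reduces to VALₙ by playing the game. Fixing the first letter of the first block to an answer
-- of VALₙ does not change satisfiability (`sat_subst_of_mem_VAL`): if f is satisfiable, some
-- witness starts with this letter; if not, no letter can make it so. One query per letter exhausts
-- the block. What remains is the universal statement coSATₙ₋₁(g), which is the negation of
-- SATₙ₋₁(¬g) (`sat_zero_cons`). A dummy block of size one at the end turns this into a question
-- with n blocks again, so the same oracle serves at every level. When all blocks are used up, a
-- constant expression is evaluated (`exec_game`).
--
-- The rest realises this on machines. Transitivity needs a machine that simulates another one and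
-- computes its oracle answers, with a bound on the length of queries. The two algorithms are
-- written in a small structured language, whose programs are compiled into oracle machines
-- (`weakReduces_of_runs`). All correctness statements carry the running time and hold for every
-- choice of oracle answers.

instance FinTM2.fintypeK (tm : FinTM2) : Fintype tm.K := tm.kFin
instance FinTM2.fintypeLabel (tm : FinTM2) : Fintype tm.Λ := tm.ΛFin
instance FinTM2.fintypeState (tm : FinTM2) : Fintype tm.σ := tm.σFin

theorem initList_eq (tm : FinTM2) (s : List (tm.Γ tm.k₀)) :
    initList tm s =
      ⟨some tm.main, tm.initialState, Function.update (fun _ => []) tm.k₀ s⟩ := by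
  unfold initList
  congr 1
  funext k
  by_cases h : k = tm.k₀
  · subst h
    simp
  · simp [h]

theorem haltList_eq (tm : FinTM2) (s : List (tm.Γ tm.k₁)) :
    haltList tm s =
      ⟨none, tm.initialState, Function.update (fun _ => []) tm.k₁ s⟩ := by
  unfold haltList
  congr 1
  funext k
  by_cases h : k = tm.k₁
  · subst h
    simp
  · simp [h]

-- Paths of an oracle machine leading to a prescribed set of configurations

namespace OracleTM

/-- Every path of `M` from the configuration `c` meets `P` within `t` steps. -/
inductive Leads (M : OracleTM) (φ : PromiseProblem) (P : M.tm.Cfg → Prop) : ℕ → M.tm.Cfg → Prop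
  | done (t : ℕ) (c : M.tm.Cfg) (h : P c) : Leads M φ P t c
  | step (t : ℕ) (c : M.tm.Cfg) (hex : ∃ c', M.Step φ c c')
      (hall : ∀ c', M.Step φ c c' → Leads M φ P t c') : Leads M φ P (t + 1) c

variable {M : OracleTM} {φ : PromiseProblem}

theorem Leads.bind {P Q : M.tm.Cfg → Prop} {t u : ℕ} {c : M.tm.Cfg} (h : Leads M φ P t c)
    (hPQ : ∀ c', P c' → Leads M φ Q u c')
    (hu : ∀ c', Leads M φ Q u c' → ∀ s, Leads M φ Q (s + u) c') :
    Leads M φ Q (t + u) c := by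
  induction h with
  | done t c h => exact hu _ (hPQ c h) t
  | step t c hex _ ih =>
    rw [Nat.add_right_comm]
    exact .step _ _ hex ih

theorem Leads.mono {P : M.tm.Cfg → Prop} {t u : ℕ} {c : M.tm.Cfg} (h : Leads M φ P t c)
    (htu : t ≤ u) : Leads M φ P u c := by
  induction h generalizing u with
  | done t c h => exact .done _ _ h
  | step t c hex _ ih =>
    obtain ⟨u, rfl⟩ : ∃ v, u = v + 1 := ⟨u - 1, by omega⟩
    exact .step _ _ hex fun c' hc => ih c' hc (by omega)

theorem Leads.trans {P Q : M.tm.Cfg → Prop} {t u : ℕ} {c : M.tm.Cfg} (h : Leads M φ P t c)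
    (hPQ : ∀ c', P c' → Leads M φ Q u c') : Leads M φ Q (t + u) c :=
  h.bind hPQ fun _ h s => h.mono (Nat.le_add_left u s)

/-- Halting with a valid output is one instance of a reachable target. The general target allows
computations to be cut into phases, which `Leads.trans` joins while adding the times. -/
theorem allPaths_iff_leads {A : Set Bool} {t : ℕ} {c : M.tm.Cfg} :
    M.AllPaths φ A t c ↔ Leads M φ (fun c => ∃ b ∈ A, c = M.halted b) t c := by
  constructor
  · intro h
    induction h with
    | halt t c b hb hc => exact .done _ _ ⟨b, hb, hc⟩
    | step t c hex _ ih => exact .step _ _ hex ih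
  · intro h
    induction h with
    | done t c h => obtain ⟨b, hb, hc⟩ := h; exact .halt _ _ b hb hc
    | step t c hex _ ih => exact .step _ _ hex ih

/-- The machine is deterministic away from query labels, so there is only one successor to follow.
-/
theorem leads_compute {P : M.tm.Cfg → Prop} {t : ℕ} {l : M.tm.Λ} {v : M.tm.σ}
    {S : ∀ k, List (M.tm.Γ k)} (hl : M.query l = none)
    (h : Leads M φ P t (TM2.stepAux (M.tm.m l) v S)) : Leads M φ P (t + 1) ⟨some l, v, S⟩ := by
  refine .step _ _ ⟨_, .compute l v S hl⟩ fun c' hc => ?_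
  cases hc with
  | compute => exact h
  | ask _ _ _ _ _ _ h' => simp [hl] at h'

theorem leads_ask {P : M.tm.Cfg → Prop} {t : ℕ} {l : M.tm.Λ} {v : M.tm.σ}
    {S : ∀ k, List (M.tm.Γ k)} {next : Bool → M.tm.Λ} (hl : M.query l = some next) {w : Word}
    (hw : (S M.queryStack).map M.queryAlphabet = w.1)
    (h : ∀ b ∈ (φ w : Set Bool),
      Leads M φ P t ⟨some (next b), v, Function.update S M.queryStack []⟩) :
    Leads M φ P (t + 1) ⟨some l, v, S⟩ := by
  -- The machine is not stuck here because every word has at least one valid answer.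
  obtain ⟨b, hb⟩ := (φ w).2
  refine .step _ _ ⟨_, .ask l v S next w b hl hw hb⟩ fun c' hc => ?_
  cases hc with
  | compute _ _ _ h' => simp [hl] at h'
  | ask _ _ _ next' w' b' h' hw' hb' =>
    obtain rfl : next = next' := by simpa [hl] using h'
    obtain rfl : w = w' := Subtype.ext (hw.symm.trans hw')
    exact h b' hb'

theorem init_eq (M : OracleTM) (x : Word) : M.init x = ⟨some M.tm.main, M.tm.initialState,
    Function.update (fun _ => []) M.tm.k₀ (x.1.map M.inputAlphabet.symm)⟩ :=
  initList_eq _ _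

theorem halted_eq (M : OracleTM) (b : Bool) : M.halted b = ⟨none, M.tm.initialState,
    Function.update (fun _ => []) M.tm.k₁ [M.outputAlphabet.symm b]⟩ :=
  haltList_eq _ _

end OracleTM

/-! ### Composition of oracle machines -/

namespace OracleTM

section Comp

variable (M N : OracleTM)

/-- The stacks of the composition: those of both machines and an auxiliary one. -/
abbrev CompStack : Type := M.tm.K ⊕ (N.tm.K ⊕ Unit)

/-- The alphabets of the composition. -/
abbrev CompAlphabet : CompStack M N → Type
  | .inl k => M.tm.Γ k
  | .inr (.inl k) => N.tm.Γ k
  | .inr (.inr _) => Bool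

/-- The labels of the composition; `inr (l, _)` serves the query at the label `l` of `M`. -/
abbrev CompLabel : Type := M.tm.Λ ⊕ (M.tm.Λ × (N.tm.Λ ⊕ Fin 3))

/-- The internal states of the composition. -/
abbrev CompState : Type := M.tm.σ × N.tm.σ × Option Bool

/-- Statements of the composition. -/
abbrev CompStmt : Type := TM2.Stmt (CompAlphabet M N) (CompLabel M N) (CompState M N)

variable {M N}

/-- The contents of all stacks of the composition. -/
def joinStacks (S : ∀ k, List (M.tm.Γ k)) (T : ∀ k, List (N.tm.Γ k)) (a : List Bool) :
    ∀ k, List (CompAlphabet M N k)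
  | .inl k => S k
  | .inr (.inl k) => T k
  | .inr (.inr _) => a

theorem update_joinStacks_left (S : ∀ k, List (M.tm.Γ k)) (T : ∀ k, List (N.tm.Γ k))
    (a : List Bool) (k : M.tm.K) (s : List (M.tm.Γ k)) :
    Function.update (joinStacks S T a) (.inl k) s = joinStacks (Function.update S k s) T a := by
  funext j
  rcases j with j | j | j
  · by_cases h : j = k
    · subst h
      exact (Function.update_self ..).trans (Function.update_self (f := S) ..).symm
    · exact (Function.update_of_ne (by simpa using h) ..).trans (Function.update_of_ne h ..).symm
  · exact Function.update_of_ne (by simp) ..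
  · exact Function.update_of_ne (by simp) ..

theorem update_joinStacks_right (S : ∀ k, List (M.tm.Γ k)) (T : ∀ k, List (N.tm.Γ k))
    (a : List Bool) (k : N.tm.K) (s : List (N.tm.Γ k)) :
    Function.update (joinStacks S T a) (.inr (.inl k)) s =
      joinStacks S (Function.update T k s) a := by
  funext j
  rcases j with j | j | j
  · exact Function.update_of_ne (by simp) ..
  · by_cases h : j = k
    · subst h
      exact (Function.update_self ..).trans (Function.update_self (f := T) ..).symm
    · exact (Function.update_of_ne (by simpa using h) ..).trans (Function.update_of_ne h ..).symm
  · exact Function.update_of_ne (by simp) ..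

theorem update_joinStacks_aux (S : ∀ k, List (M.tm.Γ k)) (T : ∀ k, List (N.tm.Γ k))
    (a s : List Bool) :
    Function.update (joinStacks S T a) (.inr (.inr ())) s = joinStacks S T s := by
  funext j
  rcases j with j | j | j
  · exact Function.update_of_ne (by simp) ..
  · exact Function.update_of_ne (by simp) ..
  · exact Function.update_self ..

variable (N) in
/-- A statement of the outer machine as one of the composition. -/
def liftOuter : TM2.Stmt M.tm.Γ M.tm.Λ M.tm.σ → CompStmt M N
  | .push k f q => .push (.inl k) (fun v => f v.1) (liftOuter q)
  | .peek k f q => .peek (.inl k) (fun v o => (f v.1 o, v.2)) (liftOuter q)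
  | .pop k f q => .pop (.inl k) (fun v o => (f v.1 o, v.2)) (liftOuter q)
  | .load f q => .load (fun v => (f v.1, v.2)) (liftOuter q)
  | .branch f p q => .branch (fun v => f v.1) (liftOuter p) (liftOuter q)
  | .goto f => .goto fun v => .inl (f v.1)
  | .halt => .halt

/-- A statement of the inner machine as one of the composition. -/
def liftInner (l : M.tm.Λ) : TM2.Stmt N.tm.Γ N.tm.Λ N.tm.σ → CompStmt M N
  | .push k f q => .push (.inr (.inl k)) (fun v => f v.2.1) (liftInner l q)
  | .peek k f q => .peek (.inr (.inl k)) (fun v o => (v.1, f v.2.1 o, v.2.2)) (liftInner l q)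
  | .pop k f q => .pop (.inr (.inl k)) (fun v o => (v.1, f v.2.1 o, v.2.2)) (liftInner l q)
  | .load f q => .load (fun v => (v.1, f v.2.1, v.2.2)) (liftInner l q)
  | .branch f p q => .branch (fun v => f v.2.1) (liftInner l p) (liftInner l q)
  | .goto f => .goto fun v => .inr (l, .inl (f v.2.1))
  | .halt => .goto fun _ => .inr (l, .inr 2)

/-- A configuration of the outer machine as one of the composition. -/
def outerCfg (c : M.tm.Cfg) : TM2.Cfg (CompAlphabet M N) (CompLabel M N) (CompState M N) :=
  ⟨c.l.map .inl, (c.var, N.tm.initialState, none), joinStacks c.stk (fun _ => []) []⟩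

/-- A configuration of the inner machine as one of the composition. -/
def innerCfg (l : M.tm.Λ) (v : M.tm.σ) (S : ∀ k, List (M.tm.Γ k)) (c : N.tm.Cfg) :
    TM2.Cfg (CompAlphabet M N) (CompLabel M N) (CompState M N) :=
  ⟨some (.inr (l, c.l.elim (.inr 2) .inl)), (v, c.var, none), joinStacks S c.stk []⟩

/-- While the outer machine runs, the stacks of the inner machine and the auxiliary stack are empty
and its state is initial. This invariant is built into `outerCfg`, so a step of the outer machine is
matched by exactly one step. -/
theorem stepAux_liftOuter (q : TM2.Stmt M.tm.Γ M.tm.Λ M.tm.σ) (v : M.tm.σ)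
    (S : ∀ k, List (M.tm.Γ k)) :
    TM2.stepAux (liftOuter N q) (v, N.tm.initialState, none) (joinStacks S (fun _ => []) []) =
      outerCfg (TM2.stepAux q v S) := by
  induction q generalizing v S with
  | push k f q ih =>
    simp only [liftOuter, TM2.stepAux]
    erw [update_joinStacks_left, ih]
    rfl
  | peek k f q ih => simp only [liftOuter, TM2.stepAux]; exact ih _ _
  | pop k f q ih =>
    simp only [liftOuter, TM2.stepAux]
    erw [update_joinStacks_left, ih]
    rfl
  | load f q ih => simp only [liftOuter, TM2.stepAux]; exact ih _ _
  | branch f p q ihp ihq =>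
    simp only [liftOuter, TM2.stepAux]
    cases f v
    · exact ihq _ _
    · exact ihp _ _
  | goto f => rfl
  | halt => rfl

theorem stepAux_liftInner (l : M.tm.Λ) (w : M.tm.σ) (T : ∀ k, List (M.tm.Γ k))
    (q : TM2.Stmt N.tm.Γ N.tm.Λ N.tm.σ) (v : N.tm.σ) (S : ∀ k, List (N.tm.Γ k)) :
    TM2.stepAux (liftInner l q) (w, v, none) (joinStacks T S []) =
      innerCfg l w T (TM2.stepAux q v S) := by
  induction q generalizing v S with
  | push k f q ih =>
    simp only [liftInner, TM2.stepAux]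
    erw [update_joinStacks_right, ih]
    rfl
  | peek k f q ih => simp only [liftInner, TM2.stepAux]; exact ih _ _
  | pop k f q ih =>
    simp only [liftInner, TM2.stepAux]
    erw [update_joinStacks_right, ih]
    rfl
  | load f q ih => simp only [liftInner, TM2.stepAux]; exact ih _ _
  | branch f p q ihp ihq =>
    simp only [liftInner, TM2.stepAux]
    cases f v
    · exact ihq _ _
    · exact ihp _ _
  | goto f => rfl
  | halt => rfl

variable (M N) in
/-- The program of the composition. -/
def compProgram : CompLabel M N → CompStmt M N
  | .inl l =>
    if (M.query l).isSome then .goto fun _ => .inr (l, .inr 0) else liftOuter N (M.tm.m l)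
  | .inr (l, .inl l') => liftInner l (N.tm.m l')
  | .inr (l, .inr 0) =>
    .pop (.inl M.queryStack) (fun v o => (v.1, v.2.1, o.map M.queryAlphabet)) <|
      .branch (fun v => v.2.2.isSome)
        (.push (.inr (.inr ())) (fun v => v.2.2.getD false) <| .goto fun _ => .inr (l, .inr 0))
        (.goto fun _ => .inr (l, .inr 1))
  | .inr (l, .inr 1) =>
    .pop (.inr (.inr ())) (fun v o => (v.1, v.2.1, o)) <|
      .branch (fun v => v.2.2.isSome)
        (.push (.inr (.inl N.tm.k₀)) (fun v => N.inputAlphabet.symm (v.2.2.getD false)) <|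
          .goto fun _ => .inr (l, .inr 1))
        (.goto fun _ => .inr (l, .inl N.tm.main))
  | .inr (l, .inr 2) =>
    .pop (.inr (.inl N.tm.k₁)) (fun v o => (v.1, v.2.1, o.map N.outputAlphabet)) <|
      .branch (fun v => v.2.2.getD false)
        (.load (fun v => (v.1, v.2.1, none)) <|
          .goto fun _ => .inl (((M.query l).getD fun _ => l) true))
        (.load (fun v => (v.1, v.2.1, none)) <|
          .goto fun _ => .inl (((M.query l).getD fun _ => l) false))

variable (M N) in
/-- The machine `M` with its oracle answers computed by the oracle machine `N`. -/
def comp : OracleTM where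
  tm :=
    { K := CompStack M N
      k₀ := .inl M.tm.k₀
      k₁ := .inl M.tm.k₁
      Γ := CompAlphabet M N
      Λ := CompLabel M N
      main := .inl M.tm.main
      σ := CompState M N
      initialState := (M.tm.initialState, N.tm.initialState, none)
      Γk₀Fin := M.tm.Γk₀Fin
      m := compProgram M N }
  inputAlphabet := M.inputAlphabet
  outputAlphabet := M.outputAlphabet
  queryStack := .inr (.inl N.queryStack)
  queryAlphabet := N.queryAlphabet
  query
    | .inr (l, .inl l') => (N.query l').map fun next b => .inr (l, .inl (next b))
    | _ => none

/-- A subroutine call is simulated step by step, its queries going to the new oracle. Halting of the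
inner machine becomes a jump to the label `inr (l, inr 2)`, so the time does not change. -/
theorem leads_comp_inner {φ : PromiseProblem} {P : N.tm.Cfg → Prop} (l : M.tm.Λ) (v : M.tm.σ)
    (S : ∀ k, List (M.tm.Γ k)) {t : ℕ} {c : N.tm.Cfg} (h : Leads N φ P t c) :
    Leads (comp M N) φ (fun c => ∃ c', P c' ∧ c = innerCfg l v S c') t (innerCfg l v S c) := by
  induction h with
  | done t c h => exact .done _ _ ⟨c, h, rfl⟩
  | step t c hex _ ih =>
    obtain ⟨c', hs⟩ := hex
    cases hs with
    | compute l' u T hq =>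
      refine leads_compute (M := comp M N) (by simp [comp, hq]) ?_
      have := ih _ (.compute l' u T hq)
      rw [← stepAux_liftInner] at this
      exact this
    | ask l' u T next w b hq hw hb =>
      refine leads_ask (M := comp M N) (w := w) (next := fun b => .inr (l, .inl (next b)))
        (by simp [comp, hq]) hw fun b' hb' => ?_
      have := ih _ (.ask l' u T next w b' hq hw hb')
      erw [update_joinStacks_right]
      exact this

theorem stepAux_read_nil (l : M.tm.Λ) (v : M.tm.σ) (r : Option Bool) (S : ∀ k, List (M.tm.Γ k))
    (T : ∀ k, List (N.tm.Γ k)) (a : List Bool) (hs : S M.queryStack = []) :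
    TM2.stepAux (compProgram M N (.inr (l, .inr 0))) (v, N.tm.initialState, r)
      (joinStacks S T a) = ⟨some (.inr (l, .inr 1)), (v, N.tm.initialState, none),
        joinStacks (Function.update S M.queryStack []) T a⟩ := by
  have e : joinStacks S T a (.inl M.queryStack) = [] := hs
  simp only [compProgram, TM2.stepAux, e, update_joinStacks_left]
  rfl

theorem stepAux_read_cons (l : M.tm.Λ) (v : M.tm.σ) (r : Option Bool) (S : ∀ k, List (M.tm.Γ k))
    (T : ∀ k, List (N.tm.Γ k)) (a : List Bool) (x : M.tm.Γ M.queryStack)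
    (s : List (M.tm.Γ M.queryStack)) (hs : S M.queryStack = x :: s) :
    TM2.stepAux (compProgram M N (.inr (l, .inr 0))) (v, N.tm.initialState, r)
      (joinStacks S T a) = ⟨some (.inr (l, .inr 0)),
        (v, N.tm.initialState, some (M.queryAlphabet x)),
        joinStacks (Function.update S M.queryStack s) T (M.queryAlphabet x :: a)⟩ := by
  have e : joinStacks S T a (.inl M.queryStack) = x :: s := hs
  simp only [compProgram, TM2.stepAux, e, update_joinStacks_left, update_joinStacks_aux]
  rfl

theorem stepAux_write_nil (l : M.tm.Λ) (v : M.tm.σ) (r : Option Bool) (S : ∀ k, List (M.tm.Γ k))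
    (T : ∀ k, List (N.tm.Γ k)) :
    TM2.stepAux (compProgram M N (.inr (l, .inr 1))) (v, N.tm.initialState, r)
      (joinStacks S T []) = ⟨some (.inr (l, .inl N.tm.main)), (v, N.tm.initialState, none),
        joinStacks S T []⟩ := by
  have e : joinStacks S T [] (.inr (.inr ())) = [] := rfl
  simp only [compProgram, TM2.stepAux, e, update_joinStacks_aux]
  rfl

theorem stepAux_write_cons (l : M.tm.Λ) (v : M.tm.σ) (r : Option Bool) (S : ∀ k, List (M.tm.Γ k))
    (s : List (N.tm.Γ N.tm.k₀)) (x : Bool) (a : List Bool) :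
    TM2.stepAux (compProgram M N (.inr (l, .inr 1))) (v, N.tm.initialState, r)
      (joinStacks S (Function.update (fun _ => []) N.tm.k₀ s) (x :: a)) =
      ⟨some (.inr (l, .inr 1)), (v, N.tm.initialState, some x),
        joinStacks S (Function.update (fun _ => []) N.tm.k₀ (N.inputAlphabet.symm x :: s)) a⟩ := by
  have e : joinStacks S (Function.update (fun _ => []) N.tm.k₀ s) (x :: a) (.inr (.inr ())) =
    x :: a := rfl
  have e' : joinStacks S (Function.update (fun _ => []) N.tm.k₀ s) a (.inr (.inl N.tm.k₀)) = s :=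
    Function.update_self (f := fun k => ([] : List (N.tm.Γ k))) ..
  simp only [compProgram, TM2.stepAux, e, update_joinStacks_aux, update_joinStacks_right,
    List.tail_cons, e', Function.update_idem]
  rfl

/-- A halting configuration has the initial state and nothing on the stacks except the output.
Popping that one letter therefore leaves the inner machine ready for its next call, without any
cleaning up. -/
theorem stepAux_answer {l : M.tm.Λ} {next : Bool → M.tm.Λ} (hl : M.query l = some next)
    (v : M.tm.σ) (S : ∀ k, List (M.tm.Γ k)) (b : Bool) :
    TM2.stepAux (compProgram M N (.inr (l, .inr 2))) (v, N.tm.initialState, none)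
      (joinStacks S (Function.update (fun _ => []) N.tm.k₁ [N.outputAlphabet.symm b]) []) =
      outerCfg ⟨some (next b), v, S⟩ := by
  have e : joinStacks S (Function.update (fun _ => []) N.tm.k₁ [N.outputAlphabet.symm b]) []
    (.inr (.inl N.tm.k₁)) = [N.outputAlphabet.symm b] :=
    Function.update_self (f := fun k => ([] : List (N.tm.Γ k))) ..
  have e' : Function.update (fun k => ([] : List (N.tm.Γ k))) N.tm.k₁ [] = fun _ => [] :=
    Function.update_eq_self ..
  simp only [compProgram, TM2.stepAux, e, update_joinStacks_right, List.tail_cons,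
    Function.update_idem, e', hl, List.head?_cons, Option.map_some, Equiv.apply_symm_apply,
    Option.getD_some]
  cases b <;> rfl

/-- Each letter takes one step, and noticing the empty stack takes one more. The query arrives
reversed on the auxiliary stack; the second loop, in `leads_comp_write`, restores its order on the
input stack of the inner machine. -/
theorem leads_comp_read {φ : PromiseProblem} {P : (comp M N).tm.Cfg → Prop} {t : ℕ} (l : M.tm.Λ)
    (v : M.tm.σ) (S : ∀ k, List (M.tm.Γ k)) (s : List (M.tm.Γ M.queryStack))
    (hs : S M.queryStack = s) (r : Option Bool) (a : List Bool)
    (h : Leads (comp M N) φ P t ⟨some (.inr (l, .inr 1)), (v, N.tm.initialState, none),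
      joinStacks (Function.update S M.queryStack []) (fun _ => [])
        ((s.map M.queryAlphabet).reverse ++ a)⟩) :
    Leads (comp M N) φ P (t + s.length + 1)
      ⟨some (.inr (l, .inr 0)), (v, N.tm.initialState, r), joinStacks S (fun _ => []) a⟩ := by
  induction s generalizing S r a with
  | nil =>
    refine leads_compute (M := comp M N) rfl ?_
    erw [stepAux_read_nil l v r S _ a hs]
    exact h
  | cons x s ih =>
    refine leads_compute (M := comp M N) rfl ?_
    erw [stepAux_read_cons l v r S _ a x s hs]
    refine ih (Function.update S M.queryStack s) (by simp) _ _ ?_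
    simpa using h

theorem leads_comp_write {φ : PromiseProblem} {P : (comp M N).tm.Cfg → Prop} {t : ℕ} (l : M.tm.Λ)
    (v : M.tm.σ) (S : ∀ k, List (M.tm.Γ k)) (r : Option Bool) (a : List Bool)
    (s : List (N.tm.Γ N.tm.k₀))
    (h : Leads (comp M N) φ P t ⟨some (.inr (l, .inl N.tm.main)), (v, N.tm.initialState, none),
      joinStacks S (Function.update (fun _ => []) N.tm.k₀
        ((a.map N.inputAlphabet.symm).reverse ++ s)) []⟩) :
    Leads (comp M N) φ P (t + a.length + 1)
      ⟨some (.inr (l, .inr 1)), (v, N.tm.initialState, r),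
        joinStacks S (Function.update (fun _ => []) N.tm.k₀ s) a⟩ := by
  induction a generalizing s r with
  | nil =>
    refine leads_compute (M := comp M N) rfl ?_
    erw [stepAux_write_nil]
    exact h
  | cons x a ih =>
    refine leads_compute (M := comp M N) rfl ?_
    erw [stepAux_write_cons]
    exact ih (some x) (N.inputAlphabet.symm x :: s) (by simpa using h)

/-- The time of a call has five parts: one step to enter, `w.1.length + 1` for each of the two
copying loops, `u` for the inner run, and one step to return the answer. -/
theorem leads_comp_query {φ φ' : PromiseProblem} {P : (comp M N).tm.Cfg → Prop} {t u : ℕ}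
    {l : M.tm.Λ} {next : Bool → M.tm.Λ} (hl : M.query l = some next) {w : Word}
    (hN : N.AllPaths φ' (φ w : Set Bool) u (N.init w)) (v : M.tm.σ) (S : ∀ k, List (M.tm.Γ k))
    (hw : (S M.queryStack).map M.queryAlphabet = w.1)
    (h : ∀ b ∈ (φ w : Set Bool), Leads (comp M N) φ' P t
      (outerCfg ⟨some (next b), v, Function.update S M.queryStack []⟩)) :
    Leads (comp M N) φ' P (u + (t + 1) + w.1.length + 1 + w.1.length + 1 + 1)
      (outerCfg ⟨some l, v, S⟩) := by
  refine leads_compute (M := comp M N) rfl ?_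
  have hgoto : compProgram M N (.inl l) = .goto fun _ => .inr (l, .inr 0) := by
    simp [compProgram, hl]
  change Leads (comp M N) φ' P _ (TM2.stepAux (compProgram M N (.inl l)) _ _)
  rw [hgoto]
  have hlen : (S M.queryStack).length = w.1.length := by simp [← hw]
  have hinner : Leads (comp M N) φ' P (u + (t + 1)) ⟨some (.inr (l, .inl N.tm.main)),
      (v, N.tm.initialState, none), joinStacks (Function.update S M.queryStack [])
        (Function.update (fun _ => []) N.tm.k₀ (w.1.map N.inputAlphabet.symm)) []⟩ := by
    have hin := leads_comp_inner (M := M) l v (Function.update S M.queryStack [])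
      (allPaths_iff_leads.1 hN)
    rw [init_eq] at hin
    refine Leads.trans hin ?_
    rintro _ ⟨_, ⟨b, hb, rfl⟩, rfl⟩
    rw [halted_eq]
    refine leads_compute (M := comp M N) rfl ?_
    erw [stepAux_answer hl]
    exact h b hb
  have hread := leads_comp_write (N := N) (φ := φ') (P := P) l v
    (Function.update S M.queryStack []) none w.1.reverse [] (by simpa using hinner)
  have := leads_comp_read (N := N) (φ := φ') (P := P) l v S _ rfl none [] (t := u + (t + 1) +
    w.1.length + 1) (by simpa [hw] using hread)
  rw [hlen] at this
  exact this

end Comp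

end OracleTM

end PromiseHierarchy

namespace PromiseHierarchy

open Turing

/-! ### Growth of the stacks -/

/-- A bound on the number of symbols that a statement pushes on any stack. -/
def stmtPushes {K : Type} {Γ : K → Type} {Λ σ : Type} : TM2.Stmt Γ Λ σ → ℕ
  | .push _ _ q => stmtPushes q + 1
  | .peek _ _ q => stmtPushes q
  | .pop _ _ q => stmtPushes q
  | .load _ q => stmtPushes q
  | .branch _ p q => stmtPushes p + stmtPushes q
  | .goto _ => 0
  | .halt => 0

theorem length_stk_stepAux_le {K : Type} [DecidableEq K] {Γ : K → Type} {Λ σ : Type}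
    (q : TM2.Stmt Γ Λ σ) (v : σ) (S : ∀ k, List (Γ k)) (k : K) :
    ((TM2.stepAux q v S).stk k).length ≤ (S k).length + stmtPushes q := by
  induction q generalizing v S with
  | push j f q ih =>
    refine (ih _ _).trans ?_
    by_cases h : k = j
    · subst h; simp [stmtPushes]; omega
    · simp [stmtPushes, h]
  | peek j f q ih => exact ih _ _
  | pop j f q ih =>
    refine (ih _ _).trans ?_
    by_cases h : k = j
    · subst h; simp [stmtPushes]
    · simp [stmtPushes, h]
  | load f q ih => exact ih _ _
  | branch f p q ihp ihq =>
    simp only [TM2.stepAux, stmtPushes]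
    cases f v
    · exact (ihq _ _).trans (by omega)
    · exact (ihp _ _).trans (by omega)
  | goto f => simp [stmtPushes]
  | halt => simp [stmtPushes]

/-- Coefficients in ℕ are nonnegative, so a time bound for long queries also covers the shorter
ones. -/
theorem eval_mono_nat (p : Polynomial ℕ) {a b : ℕ} (h : a ≤ b) : p.eval a ≤ p.eval b := by
  rw [Polynomial.eval_eq_sum_range, Polynomial.eval_eq_sum_range]
  gcongr

/-! ### Transitivity of weak reduction -/

namespace OracleTM

/-- A bound on the number of symbols pushed in one step. -/
def maxPushes (M : OracleTM) : ℕ := ∑ l, stmtPushes (M.tm.m l)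

theorem stmtPushes_le_maxPushes (M : OracleTM) (l : M.tm.Λ) :
    stmtPushes (M.tm.m l) ≤ M.maxPushes :=
  Finset.single_le_sum (f := fun l => stmtPushes (M.tm.m l)) (fun _ _ => Nat.zero_le _)
    (Finset.mem_univ l)

theorem outerCfg_halted (M N : OracleTM) (b : Bool) :
    outerCfg (N := N) (M.halted b) = (comp M N).halted b := by
  rw [halted_eq, halted_eq]
  unfold outerCfg
  dsimp only [Option.map_none]
  rw [← update_joinStacks_left]
  have : (joinStacks (fun _ => []) (fun _ => []) [] : ∀ k, List (CompAlphabet M N k)) =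
      fun _ => [] := by
    funext k
    rcases k with k | k | k <;> rfl
  rw [this]
  rfl

/-- No stack of the outer machine can become longer than `L + M.maxPushes * t` in the `t` remaining
steps. This bounds every query, hence the cost of every call, and each step of the outer machine is
charged that cost. -/
theorem AllPaths.comp {M N : OracleTM} {φ ψ : PromiseProblem} {p : Polynomial ℕ}
    (hN : ∀ w : Word, N.AllPaths ψ (φ w : Set Bool) (p.eval w.1.length) (N.init w))
    {A : Set Bool} {t : ℕ} {c : M.tm.Cfg} (h : M.AllPaths φ A t c) (L : ℕ)
    (hL : ∀ k, (c.stk k).length ≤ L) :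
    Leads (comp M N) ψ (fun c => ∃ b ∈ A, c = (OracleTM.comp M N).halted b)
      (t * (p.eval (L + M.maxPushes * t) + 2 * (L + M.maxPushes * t) + 5)) (outerCfg c) := by
  induction h generalizing L with
  | halt t c b hb hc =>
    subst hc
    exact .done _ _ ⟨b, hb, outerCfg_halted M N b⟩
  | step t c hex hall ih =>
    -- A step raises the height bound by `M.maxPushes` but uses up one unit of time, so the bound on
    -- all later queries, and with it the charge `B`, stays the same along the path.
    have e : L + M.maxPushes * (t + 1) = (L + M.maxPushes) + M.maxPushes * t := by ring
    rw [e]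
    set B := p.eval (L + M.maxPushes + M.maxPushes * t) +
      2 * (L + M.maxPushes + M.maxPushes * t) + 5 with hB
    obtain ⟨c', hs⟩ := hex
    cases hs with
    | compute l v S hq =>
      have h' := ih _ (.compute l v S hq) (L + M.maxPushes) fun k =>
        (length_stk_stepAux_le _ _ _ _).trans
          (Nat.add_le_add (hL k) (M.stmtPushes_le_maxPushes l))
      rw [← hB] at h'
      have hstep : compProgram M N (.inl l) = liftOuter N (M.tm.m l) := by
        simp [compProgram, hq]
      refine Leads.mono (t := t * B + 1) ?_ (by rw [Nat.succ_mul]; omega)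
      refine leads_compute (M := OracleTM.comp M N) rfl ?_
      change Leads (OracleTM.comp M N) ψ _ _ (TM2.stepAux (compProgram M N (.inl l)) _ _)
      rw [hstep]
      erw [stepAux_liftOuter]
      exact h'
    | ask l v S next w b hq hw hb =>
      have hlen : w.1.length ≤ L := by
        have := hL M.queryStack
        rw [← hw]
        simpa using this
      have hp := eval_mono_nat p (hlen.trans (Nat.le_add_right L
        (M.maxPushes + M.maxPushes * t)))
      rw [← Nat.add_assoc] at hp
      refine Leads.mono (leads_comp_query (t := t * B) hq (hN w) v S hw fun b' hb' => ?_) ?_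
      · refine ih _ (.ask l v S next w b' hq hw hb') _ fun k => ?_
        by_cases h : k = M.queryStack
        · subst h; simp
        · simp only [ne_eq, h, not_false_eq_true, Function.update_of_ne]
          exact (hL k).trans (Nat.le_add_right _ _)
      · rw [Nat.succ_mul]
        omega

end OracleTM

theorem WeakReduces.trans {φ₁ φ₂ φ₃ : PromiseProblem} (h₁ : WeakReduces φ₁ φ₂)
    (h₂ : WeakReduces φ₂ φ₃) : WeakReduces φ₁ φ₃ := by
  obtain ⟨M, p, hM⟩ := h₁
  obtain ⟨N, q, hN⟩ := h₂
  -- This is the bound of `AllPaths.comp` with the input length as initial height and `p` as time;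
  -- it is a polynomial because `q` is composed with one.
  refine ⟨M.comp N, p * (q.comp (.X + .C M.maxPushes * p) +
    2 * (.X + .C M.maxPushes * p) + 5), fun x => ?_⟩
  rw [OracleTM.allPaths_iff_leads]
  have h := OracleTM.AllPaths.comp hN (hM x) x.1.length fun k => by
    rw [OracleTM.init_eq]
    by_cases h : k = M.tm.k₀
    · subst h; simp
    · simp [h]
  have e : OracleTM.outerCfg (N := N) (M.init x) = (M.comp N).init x := by
    rw [OracleTM.init_eq, OracleTM.init_eq]
    unfold OracleTM.outerCfg
    dsimp only [Option.map_some]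
    rw [← OracleTM.update_joinStacks_left]
    have : (OracleTM.joinStacks (fun _ => []) (fun _ => []) [] :
        ∀ k, List (OracleTM.CompAlphabet M N k)) = fun _ => [] := by
      funext k
      rcases k with k | k | k <;> rfl
    rw [this]
    rfl
  rw [e] at h
  simpa [Polynomial.eval_comp] using h

/-! ### Strong reductions are weak reductions -/

namespace OracleTM

section Karp

variable (T : TM2ComputableAux Bool Bool)

/-- A statement followed by a query in place of halting. -/
def liftKarp : TM2.Stmt T.tm.Γ T.tm.Λ T.tm.σ →
    TM2.Stmt T.tm.Γ (T.tm.Λ ⊕ Option Bool) T.tm.σ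
  | .push k f q => .push k f (liftKarp q)
  | .peek k f q => .peek k f (liftKarp q)
  | .pop k f q => .pop k f (liftKarp q)
  | .load f q => .load f (liftKarp q)
  | .branch f p q => .branch f (liftKarp p) (liftKarp q)
  | .goto f => .goto fun v => .inl (f v)
  | .halt => .goto fun _ => .inr none

/-- The oracle machine that computes one query by `T` and answers with the answer received. -/
def karp : OracleTM where
  tm :=
    { K := T.tm.K
      k₀ := T.tm.k₀
      k₁ := T.tm.k₁
      Γ := T.tm.Γ
      Λ := T.tm.Λ ⊕ Option Bool
      main := .inl T.tm.main
      σ := T.tm.σ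
      initialState := T.tm.initialState
      Γk₀Fin := T.tm.Γk₀Fin
      m := fun
        | .inl l => liftKarp T (T.tm.m l)
        | .inr none => .halt
        | .inr (some b) => .push T.tm.k₁ (fun _ => T.outputAlphabet.symm b) .halt }
  inputAlphabet := T.inputAlphabet
  outputAlphabet := T.outputAlphabet
  queryStack := T.tm.k₁
  queryAlphabet := T.outputAlphabet
  query
    | .inr none => some fun b => .inr (some b)
    | _ => none

/-- A configuration of `T` as one of `karp T`. -/
def karpCfg (c : T.tm.Cfg) : (karp T).tm.Cfg :=
  ⟨some (c.l.elim (.inr none) .inl), c.var, c.stk⟩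

theorem stepAux_liftKarp (q : TM2.Stmt T.tm.Γ T.tm.Λ T.tm.σ) (v : T.tm.σ)
    (S : ∀ k, List (T.tm.Γ k)) :
    TM2.stepAux (liftKarp T q) v S = karpCfg T (TM2.stepAux q v S) := by
  induction q generalizing v S with
  | push k f q ih => exact ih _ _
  | peek k f q ih => exact ih _ _
  | pop k f q ih => exact ih _ _
  | load f q ih => exact ih _ _
  | branch f p q ihp ihq =>
    simp only [liftKarp, TM2.stepAux]
    cases f v
    · exact ihq _ _
    · exact ihp _ _
  | goto f => rfl
  | halt => rfl

theorem iterate_bind_none {σ : Type} (f : σ → Option σ) (n : ℕ) :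
    (flip bind f)^[n] none = none := by
  induction n with
  | zero => rfl
  | succ n ih => rw [Function.iterate_succ_apply]; exact ih

/-- The iteration reaches `some c'` only if `T` has not halted earlier, since `none` is absorbing.
Up to there the runs agree, and a halted configuration of `T` corresponds to one at the query label.
-/
theorem leads_karp {φ : PromiseProblem} {n : ℕ} {c c' : T.tm.Cfg}
    (h : (flip bind T.tm.step)^[n] (some c) = some c') :
    Leads (karp T) φ (fun d => d = karpCfg T c') n (karpCfg T c) := by
  induction n generalizing c with
  | zero =>
    obtain rfl : c = c' := by simpa using h
    exact .done _ _ rfl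
  | succ n ih =>
    rw [Function.iterate_succ_apply] at h
    obtain ⟨l, v, S⟩ := c
    cases l with
    | none =>
      change (flip bind T.tm.step)^[n] none = some c' at h
      rw [iterate_bind_none] at h
      simp at h
    | some l =>
      refine leads_compute (M := karp T) rfl ?_
      erw [stepAux_liftKarp T (T.tm.m l) v S]
      exact ih h

end Karp

end OracleTM

theorem StrongReduces.weakReduces {φ₁ φ₂ : PromiseProblem} (h : StrongReduces φ₁ φ₂) :
    WeakReduces φ₁ φ₂ := by
  obtain ⟨μ, ⟨C⟩, hμ⟩ := h
  -- The two extra steps are the query and the writing of its answer. The output stack of the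
  -- many-one reduction doubles as the query stack, and the query empties it.
  refine ⟨OracleTM.karp C.toTM2ComputableAux, C.time + 2, fun x => ?_⟩
  rw [OracleTM.allPaths_iff_leads]
  have hC := C.outputsFun x
  have hrun := OracleTM.leads_karp (φ := φ₂) C.toTM2ComputableAux hC.evals_in_steps
  simp only [Polynomial.eval_add, Polynomial.eval_ofNat]
  refine OracleTM.Leads.trans (M := OracleTM.karp C.toTM2ComputableAux) (hrun.mono hC.steps_le_m) ?_
  rintro _ rfl
  rw [haltList_eq]
  refine OracleTM.leads_ask (M := OracleTM.karp C.toTM2ComputableAux) (w := μ x) rfl ?_ ?_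
  · refine (congrArg (List.map C.outputAlphabet) (Function.update_self
      (f := fun k => ([] : List (C.tm.Γ k))) ..)).trans ?_
    rw [List.map_map, Equiv.invFun_as_coe, Equiv.self_comp_symm, List.map_id]
  · intro b hb
    have e : Function.update (Function.update (fun k => ([] : List (C.tm.Γ k))) C.tm.k₁
        ((μ x).1.map C.outputAlphabet.invFun)) C.tm.k₁ [] = fun _ => [] := by
      rw [Function.update_idem]
      exact Function.update_eq_self ..
    refine OracleTM.leads_compute (M := OracleTM.karp C.toTM2ComputableAux) rfl ?_
    refine .done _ _ ⟨b, hμ x hb, ?_⟩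
    rw [OracleTM.halted_eq]
    change TM2.stepAux (.push C.tm.k₁ (fun _ => C.outputAlphabet.symm b) .halt) C.tm.initialState
      (Function.update (Function.update (fun k => ([] : List (C.tm.Γ k))) C.tm.k₁
        ((μ x).1.map C.outputAlphabet.invFun)) C.tm.k₁ []) = _
    rw [e]
    rfl

end PromiseHierarchy

namespace PromiseHierarchy

open Turing

/-! ### Structured programs over stacks of bits -/

/-- Structured programs over stacks of bits indexed by `K`, with an oracle. -/
inductive Prog (K : Type) : Type
  | skip : Prog K
  | push (k : K) (b : Bool) (p : Prog K) : Prog K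
  | pop (k : K) (p : Option Bool → Prog K) : Prog K
  | seq (p p' : Prog K) : Prog K
  | loop (k : K) (p : Bool → Prog K) : Prog K
  | ask (p : Bool → Prog K) : Prog K

/-- `Runs q φ p s t Q`: every run of `p` on the stacks `s`, with queries from the stack `q` to
`φ`, ends within `t` steps with stacks that satisfy `Q`. -/
inductive Runs {K : Type} [DecidableEq K] (q : K) (φ : PromiseProblem) :
    Prog K → (K → List Bool) → ℕ → ((K → List Bool) → Prop) → Prop
  | skip {s t Q} (h : Q s) : Runs q φ .skip s (t + 1) Q
  | push {k b p s t Q} (h : Runs q φ p (Function.update s k (b :: s k)) t Q) :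
      Runs q φ (.push k b p) s (t + 1) Q
  | pop {k p s t Q} (h : Runs q φ (p (s k).head?) (Function.update s k (s k).tail) t Q) :
      Runs q φ (.pop k p) s (t + 1) Q
  | seq {p p' s t u Q} (R : (K → List Bool) → Prop) (h : Runs q φ p s t R)
      (h' : ∀ s', R s' → Runs q φ p' s' u Q) : Runs q φ (.seq p p') s (t + u) Q
  | loop_nil {k p s t Q} (hs : s k = []) (h : Q s) : Runs q φ (.loop k p) s (t + 1) Q
  | loop_cons {k p s t u Q b l} (hs : s k = b :: l) (R : (K → List Bool) → Prop)
      (h : Runs q φ (p b) (Function.update s k l) t R)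
      (h' : ∀ s', R s' → Runs q φ (.loop k p) s' u Q) : Runs q φ (.loop k p) s (t + u + 1) Q
  | ask {p s t Q} (w : Word) (hw : s q = w.1)
      (h : ∀ b ∈ (φ w : Set Bool), Runs q φ (p b) (Function.update s q []) t Q) :
      Runs q φ (.ask p) s (t + 1) Q

namespace Runs

variable {K : Type} [DecidableEq K] {q : K} {φ : PromiseProblem} {p p' : Prog K}
  {s : K → List Bool} {t u : ℕ} {Q R : (K → List Bool) → Prop}

theorem imp (h : Runs q φ p s t Q) (hQ : ∀ s', Q s' → R s') : Runs q φ p s t R := by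
  induction h with
  | skip h => exact .skip (hQ _ h)
  | push _ ih => exact .push (ih hQ)
  | pop _ ih => exact .pop (ih hQ)
  | seq R' h _ _ ih' => exact .seq R' h fun s' hs => ih' s' hs hQ
  | loop_nil hs h => exact .loop_nil hs (hQ _ h)
  | loop_cons hs R' h _ _ ih' => exact .loop_cons hs R' h fun s' hs => ih' s' hs hQ
  | ask w hw _ ih => exact .ask w hw fun b hb => ih b hb hQ

theorem mono (h : Runs q φ p s t Q) (htu : t ≤ u) : Runs q φ p s u Q := by
  induction h generalizing u with
  | skip h =>
    obtain ⟨u, rfl⟩ : ∃ v, u = v + 1 := ⟨u - 1, by omega⟩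
    exact .skip h
  | push _ ih =>
    obtain ⟨u, rfl⟩ : ∃ v, u = v + 1 := ⟨u - 1, by omega⟩
    exact .push (ih (by omega))
  | pop _ ih =>
    obtain ⟨u, rfl⟩ : ∃ v, u = v + 1 := ⟨u - 1, by omega⟩
    exact .pop (ih (by omega))
  | @seq _ _ _ t t' _ R' h _ _ ih' =>
    obtain ⟨u, rfl⟩ : ∃ v, u = t + v := ⟨u - t, by omega⟩
    exact .seq R' h fun s' hs => ih' s' hs (by omega)
  | loop_nil hs h =>
    obtain ⟨u, rfl⟩ : ∃ v, u = v + 1 := ⟨u - 1, by omega⟩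
    exact .loop_nil hs h
  | @loop_cons _ _ _ t t' _ _ _ hs R' h _ _ ih' =>
    obtain ⟨u, rfl⟩ : ∃ v, u = t + v + 1 := ⟨u - t - 1, by omega⟩
    exact .loop_cons hs R' h fun s' hs => ih' s' hs (by omega)
  | ask w hw _ ih =>
    obtain ⟨u, rfl⟩ : ∃ v, u = v + 1 := ⟨u - 1, by omega⟩
    exact .ask w hw fun b hb => ih b hb (by omega)

/-- A program pushes at most one bit in a step. -/
theorem length_le (h : Runs q φ p s t Q) (L : ℕ) (hL : ∀ k, (s k).length ≤ L) :
    Runs q φ p s t fun s' => Q s' ∧ ∀ k, (s' k).length ≤ L + t := by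
  induction h generalizing L with
  | skip h => exact .skip ⟨h, fun k => (hL k).trans (by omega)⟩
  | @push k b _ s t _ _ ih =>
    refine .push ((ih (L + 1) fun j => ?_).imp fun s' h => ⟨h.1, fun j => (h.2 j).trans (by omega)⟩)
    by_cases h : j = k
    · subst h; simpa using hL j
    · simpa [h] using (hL j).trans (Nat.le_succ L)
  | @pop k _ s t _ _ ih =>
    refine .pop ((ih L fun j => ?_).imp fun s' h => ⟨h.1, fun j => (h.2 j).trans (by omega)⟩)
    by_cases h : j = k
    · subst h; simpa using (Nat.sub_le _ 1).trans (hL j)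
    · simpa [h] using hL j
  | @seq _ _ _ t u _ R' _ _ ih ih' =>
    exact .seq _ (ih L hL) fun s' hs => (ih' s' hs.1 _ hs.2).imp fun s'' h =>
      ⟨h.1, fun j => (h.2 j).trans (by omega)⟩
  | loop_nil hs h => exact .loop_nil hs ⟨h, fun k => (hL k).trans (by omega)⟩
  | @loop_cons k _ s t u _ b l hs R' _ _ ih ih' =>
    refine .loop_cons hs _ (ih L fun j => ?_) fun s' hs => (ih' s' hs.1 _ hs.2).imp fun s'' h =>
      ⟨h.1, fun j => (h.2 j).trans (by omega)⟩
    by_cases h : j = k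
    · subst h
      have := hL j
      rw [hs] at this
      simp at this ⊢
      omega
    · simpa [h] using hL j
  | @ask _ s t _ w hw _ ih =>
    refine .ask w hw fun b hb => (ih b hb L fun j => ?_).imp fun s' h =>
      ⟨h.1, fun j => (h.2 j).trans (by omega)⟩
    by_cases h : j = q
    · subst h; simp
    · simpa [h] using hL j

end Runs

-- Compilation of structured programs into oracle machines

namespace Prog

variable {K : Type}

/-- The labels of the machine for a program. -/
def Label : Prog K → Type
  | skip => Unit
  | push _ _ p => Option (Label p)
  | pop _ p => Option (Σ o, Label (p o))
  | seq p p' => Label p ⊕ Label p'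
  | loop _ p => Option (Σ b, Label (p b))
  | ask p => Option (Σ b, Label (p b))

instance fintypeLabel : (p : Prog K) → Fintype (Label p)
  | skip => inferInstanceAs (Fintype Unit)
  | push _ _ p => @instFintypeOption _ (fintypeLabel p)
  | pop _ p => @instFintypeOption _ (@Sigma.instFintype _ _ (fun o => fintypeLabel (p o)) _)
  | seq p p' => @instFintypeSum _ _ (fintypeLabel p) (fintypeLabel p')
  | loop _ p => @instFintypeOption _ (@Sigma.instFintype _ _ (fun b => fintypeLabel (p b)) _)
  | ask p => @instFintypeOption _ (@Sigma.instFintype _ _ (fun b => fintypeLabel (p b)) _)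

/-- The label at which a program starts. -/
def entry : (p : Prog K) → Label p
  | skip => ()
  | push _ _ _ => (none : Option _)
  | pop _ _ => (none : Option _)
  | seq p _ => .inl (entry p)
  | loop _ _ => (none : Option _)
  | ask _ => (none : Option _)

/-- What a machine does at a label: a statement or a query. -/
abbrev Action (K Λ : Type) : Type :=
  TM2.Stmt (fun _ : K => Bool) Λ (Option Bool) × Option (Bool → Λ)

/-- The actions of a program whose labels are embedded by `e` and which continues at `x`. -/
def actions {Λ : Type} : (p : Prog K) → (e : Label p → Λ) → (x : Λ) → Label p → Action K Λ
  | skip, _, x, _ => (.goto fun _ => x, none)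
  | push k b p, e, _, none => (.push k (fun _ => b) (.goto fun _ => e (some (entry p))), none)
  | push _ _ p, e, x, some l => actions p (fun l => e (some l)) x l
  | pop k p, e, _, none => (.pop k (fun _ o => o) (.goto fun o => e (some ⟨o, entry (p o)⟩)), none)
  | pop _ p, e, x, some ⟨o, l⟩ => actions (p o) (fun l => e (some ⟨o, l⟩)) x l
  | seq p p', e, _, .inl l => actions p (fun l => e (.inl l)) (e (.inr (entry p'))) l
  | seq _ p', e, x, .inr l => actions p' (fun l => e (.inr l)) x l
  | loop k p, e, x, none => (.pop k (fun _ o => o)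
      (.goto fun o => o.elim x fun b => e (some ⟨b, entry (p b)⟩)), none)
  | loop _ p, e, _, some ⟨b, l⟩ => actions (p b) (fun l => e (some ⟨b, l⟩)) (e none) l
  | ask p, e, _, none => (.halt, some fun b => e (some ⟨b, entry (p b)⟩))
  | ask p, e, x, some ⟨b, l⟩ => actions (p b) (fun l => e (some ⟨b, l⟩)) x l

end Prog

namespace OracleTM

/-- The oracle machine with the given actions. -/
def ofActions {K : Type} [DecidableEq K] [Fintype K] (k₀ k₁ q : K) {Λ : Type} [Fintype Λ]
    (main : Λ) (a : Λ → Prog.Action K Λ) : OracleTM where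
  tm :=
    { K := K
      k₀ := k₀
      k₁ := k₁
      Γ := fun _ => Bool
      Λ := Λ
      main := main
      σ := Option Bool
      initialState := none
      Γk₀Fin := inferInstanceAs (Fintype Bool)
      m := fun l => (a l).1 }
  inputAlphabet := Equiv.refl Bool
  outputAlphabet := Equiv.refl Bool
  queryStack := q
  queryAlphabet := Equiv.refl Bool
  query := fun l => (a l).2

end OracleTM

/-- A step of the machine at a label that is not a query. -/
theorem OracleTM.leads_ofActions {K : Type} [DecidableEq K] [Fintype K] {k₀ k₁ q : K} {Λ : Type}
    [Fintype Λ] {main : Λ} {a : Λ → Prog.Action K Λ} {φ : PromiseProblem}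
    {P : (ofActions k₀ k₁ q main a).tm.Cfg → Prop} {t : ℕ} {l : Λ}
    {st : TM2.Stmt (fun _ : K => Bool) Λ (Option Bool)} (hl : a l = (st, none)) {v : Option Bool}
    {s : K → List Bool} (h : Leads (ofActions k₀ k₁ q main a) φ P t (TM2.stepAux st v s)) :
    Leads (ofActions k₀ k₁ q main a) φ P (t + 1) ⟨some l, v, s⟩ := by
  refine leads_compute (M := ofActions k₀ k₁ q main a) (congrArg Prod.snd hl) ?_
  have : (ofActions k₀ k₁ q main a).tm.m l = st := congrArg Prod.fst hl
  rw [this]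
  exact h

/-- Only the labels in the image of `e` are constrained, so the statement applies to a program
placed anywhere inside a larger machine, and the induction can descend to subprograms. The register
`v` is arbitrary because a pop overwrites it before it is used. -/
theorem Runs.leads {K : Type} [DecidableEq K] [Fintype K] {k₀ k₁ q : K} {Λ : Type} [Fintype Λ]
    {main : Λ} {a : Λ → Prog.Action K Λ} {φ : PromiseProblem} {p : Prog K}
    {s : K → List Bool} {t : ℕ} {Q : (K → List Bool) → Prop} (h : Runs q φ p s t Q)
    (e : p.Label → Λ) (x : Λ) (ha : ∀ l, a (e l) = p.actions e x l) (v : Option Bool) :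
    OracleTM.Leads (OracleTM.ofActions k₀ k₁ q main a) φ
      (fun c => ∃ v s', Q s' ∧ c = ⟨some x, v, s'⟩) t ⟨some (e p.entry), v, s⟩ := by
  induction h generalizing x v with
  | skip h =>
    have h0 := ha ()
    refine OracleTM.leads_ofActions h0 ?_
    exact .done _ _ ⟨_, _, h, rfl⟩
  | push _ ih =>
    have h0 := ha (none : Option _)
    refine OracleTM.leads_ofActions h0 ?_
    exact ih _ _ (fun l => ha (some l)) _
  | @pop k p s t Q _ ih =>
    have h0 := ha (none : Option _)
    refine OracleTM.leads_ofActions h0 ?_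
    exact ih (fun l => e (some ⟨_, l⟩)) _ (fun l => ha (some ⟨_, l⟩)) _
  | seq R _ _ ih ih' =>
    refine (ih (fun l => e (.inl l)) _ (fun l => ha (.inl l)) v).trans ?_
    rintro _ ⟨v', s', hs', rfl⟩
    exact ih' s' hs' (fun l => e (.inr l)) _ (fun l => ha (.inr l)) v'
  | @loop_nil k p s t Q hs h =>
    have h0 := ha (none : Option _)
    refine OracleTM.leads_ofActions h0 ?_
    refine .done _ _ ⟨none, s, h, ?_⟩
    simp only [TM2.stepAux, hs]
    have : Function.update s k ([] : List Bool).tail = s := by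
      rw [List.tail_nil, ← hs, Function.update_eq_self]
    exact congrArg (TM2.Cfg.mk (Γ := fun _ => Bool) (some x) none) this
  | @loop_cons k p s t u Q b l hs R _ _ ih ih' =>
    have h0 := ha (none : Option _)
    refine OracleTM.leads_ofActions h0 ?_
    simp only [TM2.stepAux, hs]
    refine (ih (fun l => e (some ⟨b, l⟩)) (e (none : Option _)) (fun l => ha (some ⟨b, l⟩))
      _).trans ?_
    rintro _ ⟨v', s', hs', rfl⟩
    exact ih' s' hs' e x ha v'
  | @ask p s t Q w hw _ ih =>
    have h0 := ha (none : Option _)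
    refine OracleTM.leads_ask (M := OracleTM.ofActions k₀ k₁ q main a) (congrArg Prod.snd h0)
      (w := w) ((List.map_id _).trans hw) fun b hb => ?_
    exact ih b hb (fun l => e (some ⟨b, l⟩)) _ (fun l => ha (some ⟨b, l⟩)) v

-- Clearing the stacks, and reductions from programs

namespace Prog

variable {K : Type}

/-- Empty all the given stacks. -/
def drain : List K → Prog K
  | [] => skip
  | k :: ks => seq (loop k fun _ => skip) (drain ks)

end Prog

theorem Runs.loop_skip {K : Type} [DecidableEq K] {q : K} {φ : PromiseProblem} {k : K} (n : ℕ)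
    (s : K → List Bool) (hn : (s k).length ≤ n) :
    Runs q φ (.loop k fun _ => .skip) s (2 * n + 1) (· = Function.update s k []) := by
  induction n generalizing s with
  | zero =>
    have : s k = [] := by simpa using hn
    refine .loop_nil this ?_
    rw [← this, Function.update_eq_self]
  | succ n ih =>
    cases hs : s k with
    | nil =>
      refine .loop_nil hs ?_
      rw [← hs, Function.update_eq_self]
    | cons b l =>
      refine Runs.mono (.loop_cons (t := 1) (u := 2 * n + 1) hs (· = Function.update s k l)
        (.skip rfl) ?_) (by omega)
      rintro _ rfl
      refine (ih _ (by simpa [hs] using hn)).imp ?_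
      simp

theorem Runs.drain {K : Type} [DecidableEq K] {q : K} {φ : PromiseProblem} (n : ℕ) (ks : List K)
    (s : K → List Bool) (hn : ∀ k, (s k).length ≤ n) :
    Runs q φ (.drain ks) s (ks.length * (2 * n + 1) + 1)
      (· = fun k => if k ∈ ks then [] else s k) := by
  induction ks generalizing s with
  | nil => exact .skip (by simp)
  | cons k ks ih =>
    refine Runs.mono (.seq _ (Runs.loop_skip n s (hn k)) (u := ks.length * (2 * n + 1) + 1) ?_)
      (by
        have : (ks.length + 1) * (2 * n + 1) = ks.length * (2 * n + 1) + (2 * n + 1) := by ring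
        simp only [List.length_cons]
        omega)
    rintro _ rfl
    refine (ih _ fun j => ?_).imp ?_
    · by_cases h : j = k
      · subst h; simp
      · simpa [h] using hn j
    · rintro _ rfl
      funext j
      by_cases h : j = k
      · subst h; simp
      · simp [h]

/-- A program that runs in polynomial time gives a weak reduction. -/
theorem weakReduces_of_runs {K : Type} [DecidableEq K] [Fintype K] {φ₁ φ₂ : PromiseProblem}
    (k₀ k₁ q : K) (p : Prog K) (T : Polynomial ℕ)
    (h : ∀ x : Word, Runs q φ₂ p (Function.update (fun _ => []) k₀ x.1) (T.eval x.1.length)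
      fun s => ∃ b ∈ (φ₁ x : Set Bool), s k₁ = [b]) : WeakReduces φ₁ φ₂ := by
  classical
  -- A halted machine must have empty stacks apart from its output, hence the final cleaning.
  set ks : List K := (Finset.univ.erase k₁).toList with hks
  set p' : Prog K := .seq p (.drain ks) with hp'
  -- The additional label `none` resets the register to its initial value and halts.
  set a : Option p'.Label → Prog.Action K (Option p'.Label) := fun
    | none => (.load (fun _ => none) .halt, none)
    | some l => p'.actions some none l with ha
  set M := OracleTM.ofActions k₀ k₁ q (some p'.entry) a with hM
  -- After `T` steps every stack has at most the input length plus `T` letters, because a program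
  -- pushes at most one letter per step. The second summand is the time to drain stacks of that
  -- height, and the last one is for halting.
  refine ⟨M, T + (.C ks.length * (2 * (.X + T) + 1) + 1) + 1, fun x => ?_⟩
  rw [OracleTM.allPaths_iff_leads]
  have h₁ : Runs q φ₂ p' (Function.update (fun _ => []) k₀ x.1)
      (T.eval x.1.length + (ks.length * (2 * (x.1.length + T.eval x.1.length) + 1) + 1))
      fun s => ∃ b ∈ (φ₁ x : Set Bool), s = Function.update (fun _ => []) k₁ [b] := by
    refine .seq _ ((h x).length_le x.1.length fun k => ?_) fun s hs =>
      (Runs.drain _ ks s hs.2).imp ?_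
    · by_cases hk : k = k₀
      · subst hk; simp
      · simp [hk]
    · rintro _ rfl
      obtain ⟨⟨b, hb, hsb⟩, -⟩ := hs
      refine ⟨b, hb, ?_⟩
      funext k
      by_cases hk : k = k₁
      · subst hk; simp [hks, hsb]
      · simp [hks, hk]
  have h₂ := h₁.leads (k₀ := k₀) (k₁ := k₁) (main := some p'.entry) (a := a) some none
    (fun l => rfl) none
  simp only [Polynomial.eval_add, Polynomial.eval_mul, Polynomial.eval_C, Polynomial.eval_X,
    Polynomial.eval_one, Polynomial.eval_ofNat]
  have e : M.init x = ⟨some (some p'.entry), none, Function.update (fun _ => []) k₀ x.1⟩ := by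
    rw [OracleTM.init_eq]
    change (⟨some (some p'.entry), none, Function.update (fun _ => []) k₀ (x.1.map id)⟩ :
      TM2.Cfg (fun _ : K => Bool) _ (Option Bool)) = _
    rw [List.map_id]
    rfl
  rw [e]
  refine h₂.trans ?_
  rintro _ ⟨v, s, ⟨b, hb, rfl⟩, rfl⟩
  refine OracleTM.leads_compute (M := M) rfl (.done _ _ ⟨b, hb, ?_⟩)
  rw [OracleTM.halted_eq]
  rfl

end PromiseHierarchy

namespace PromiseHierarchy

/-! ### Alternating satisfiability -/

/-- De Morgan for alternating quantifiers; the two halves need each other, since removing a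
quantifier exchanges the roles. -/
theorem sat_coSat_not {ms : List ℕ} {f : List (List Bool) → Bool} :
    (Sat ms (fun ys => !f ys) ↔ ¬ CoSat ms f) ∧ (CoSat ms (fun ys => !f ys) ↔ ¬ Sat ms f) := by
  induction ms generalizing f with
  | nil => simp [Sat, CoSat]
  | cons m ms ih =>
    simp only [Sat, CoSat, not_forall, not_exists, not_and, exists_prop]
    exact ⟨exists_congr fun x => and_congr_right fun _ => ih.2,
      forall_congr' fun x => imp_congr_right fun _ => ih.1⟩

/-- Quantifiers over a nonempty range are vacuous on a constant function. Blocks of size one serve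
as padding. -/
theorem sat_coSat_replicate {d : ℕ} {f : List (List Bool) → Bool} (h : ∀ zs, f zs = f []) :
    (Sat (List.replicate d 1) f ↔ f [] = true) ∧ (CoSat (List.replicate d 1) f ↔ f [] = true) := by
  induction d generalizing f with
  | zero => simp [Sat, CoSat]
  | succ d ih =>
    have h' (x : List Bool) := ih (f := fun ys => f (x :: ys)) fun zs => by
      rw [h (x :: zs), h [x]]
    simp only [List.replicate_succ, Sat, CoSat]
    constructor
    · constructor
      · rintro ⟨x, -, hx⟩
        rw [← h [x]]
        exact (h' x).2.1 hx
      · intro hf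
        exact ⟨[true], rfl, (h' _).2.2 (by rw [h]; exact hf)⟩
    · constructor
      · intro hx
        rw [← h [[true]]]
        exact (h' _).1.1 (hx [true] rfl)
      · intro hf x _
        exact (h' _).1.2 (by rw [h]; exact hf)

/-- Blocks on which the function does not depend may be dropped at the end. -/
theorem sat_coSat_append_replicate {ms : List ℕ} {d : ℕ} {f : List (List Bool) → Bool}
    (h : ∀ ys zs, ys.length = ms.length → f (ys ++ zs) = f ys) :
    (Sat (ms ++ List.replicate d 1) f ↔ Sat ms f) ∧
      (CoSat (ms ++ List.replicate d 1) f ↔ CoSat ms f) := by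
  induction ms generalizing f with
  | nil =>
    have := sat_coSat_replicate (d := d) (f := f) fun zs => h [] zs rfl
    simpa [Sat, CoSat] using this
  | cons m ms ih =>
    have h' (x : List Bool) := ih (f := fun ys => f (x :: ys)) fun ys zs hys =>
      h (x :: ys) zs (by simp [hys])
    simp only [List.cons_append, Sat, CoSat]
    exact ⟨exists_congr fun x => and_congr_right fun _ => (h' x).2,
      forall_congr' fun x => imp_congr_right fun _ => (h' x).1⟩

/-! ### Boolean expressions with constants -/

/-- Tokens: `(0, a, b)` for the token `ab` of an expression, `(1, 0, c)` for the constant `c`, and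
`(1, 1, b)` for the bit `b` of a unary number. -/
abbrev Tok : Type := Bool × Bool × Bool

/-- The bits of a unary number as tokens. -/
def bitToks (l : List Bool) : List Tok := l.map fun b => (true, true, b)

/-- Boolean expressions with constants. -/
inductive XExpr : Type
  | const (c : Bool) : XExpr
  | var (i j : ℕ) : XExpr
  | neg (f : XExpr) : XExpr
  | and (f g : XExpr) : XExpr
  | or (f g : XExpr) : XExpr

namespace XExpr

/-- The value of an expression. -/
def eval : XExpr → List (List Bool) → Bool
  | const c, _ => c
  | var i j, ys => (ys.getD i []).getD j false
  | neg f, ys => !f.eval ys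
  | and f g, ys => f.eval ys && g.eval ys
  | or f g, ys => f.eval ys || g.eval ys

/-- All variables belong to blocks of the sizes `ms`. -/
def WF (ms : List ℕ) : XExpr → Prop
  | const _ => True
  | var i j => j < ms.getD i 0
  | neg f => f.WF ms
  | and f g => f.WF ms ∧ g.WF ms
  | or f g => f.WF ms ∧ g.WF ms

/-- The tokens of an expression. -/
def toks : XExpr → List Tok
  | const c => [(true, false, c)]
  | var i j => (false, true, true) :: bitToks (unary i ++ unary j)
  | neg f => (false, false, false) :: f.toks
  | and f g => (false, false, true) :: (f.toks ++ g.toks)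
  | or f g => (false, true, false) :: (f.toks ++ g.toks)

/-- An expression without constants as one with constants. -/
def ofBool : BoolExpr → XExpr
  | .var i j => var i j
  | .neg f => neg (ofBool f)
  | .and f g => and (ofBool f) (ofBool g)
  | .or f g => or (ofBool f) (ofBool g)

/-- Constants expressed by the first variable. -/
def toBool : XExpr → BoolExpr
  | const true => .or (.var 0 0) (.neg (.var 0 0))
  | const false => .and (.var 0 0) (.neg (.var 0 0))
  | var i j => .var i j
  | neg f => .neg f.toBool
  | and f g => .and f.toBool g.toBool
  | or f g => .or f.toBool g.toBool

/-- The first variable of the first block fixed to `b`. -/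
def subst (b : Bool) : XExpr → XExpr
  | const c => const c
  | var 0 0 => const b
  | var 0 (j + 1) => var 0 j
  | var (i + 1) j => var (i + 1) j
  | neg f => neg (f.subst b)
  | and f g => and (f.subst b) (g.subst b)
  | or f g => or (f.subst b) (g.subst b)

/-- The exhausted first block removed. -/
def shift : XExpr → XExpr
  | const c => const c
  | var 0 _ => const false
  | var (i + 1) j => var i j
  | neg f => neg f.shift
  | and f g => and f.shift g.shift
  | or f g => or f.shift g.shift

theorem eval_ofBool (f : BoolExpr) (ys : List (List Bool)) : (ofBool f).eval ys = f.eval ys := by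
  induction f <;> simp_all [ofBool, eval, BoolExpr.eval]

theorem wf_ofBool (f : BoolExpr) (ms : List ℕ) : (ofBool f).WF ms ↔ f.WellFormed ms := by
  induction f <;> simp_all [ofBool, WF, BoolExpr.WellFormed]

theorem eval_toBool (f : XExpr) (ys : List (List Bool)) : f.toBool.eval ys = f.eval ys := by
  induction f with
  | const c => cases c <;> simp [toBool, eval, BoolExpr.eval]
  | _ => simp_all [toBool, eval, BoolExpr.eval]

/-- Constants are written with the first variable, which exists because the first block has size `m
+ 1`. The condition is met at every query, as one is asked only while the first block has letters
left. -/
theorem wf_toBool (f : XExpr) {m : ℕ} {ms ls : List ℕ} (h : f.WF ((m + 1) :: ms)) :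
    f.toBool.WellFormed ((m + 1) :: ms ++ ls) := by
  induction f with
  | const c => cases c <;> simp [toBool, BoolExpr.WellFormed]
  | var i j =>
    simp only [WF, toBool, BoolExpr.WellFormed] at h ⊢
    by_cases hi : i < ((m + 1) :: ms).length
    · rwa [List.getD_append _ _ _ _ hi]
    · rw [List.getD_eq_default _ _ (by omega)] at h
      omega
  | neg f ih => exact ih h
  | and f g ihf ihg => exact ⟨ihf h.1, ihg h.2⟩
  | or f g ihf ihg => exact ⟨ihf h.1, ihg h.2⟩

theorem eval_append (f : XExpr) {ms : List ℕ} (h : f.WF ms) (ys zs : List (List Bool))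
    (hys : ys.length = ms.length) : f.eval (ys ++ zs) = f.eval ys := by
  induction f with
  | const c => rfl
  | var i j =>
    simp only [WF, eval] at h ⊢
    by_cases hi : i < ms.length
    · rw [List.getD_append _ _ _ _ (by omega)]
    · rw [List.getD_eq_default _ _ (by omega)] at h
      omega
  | neg f ih => simp [eval, ih h]
  | and f g ihf ihg => simp [eval, ihf h.1, ihg h.2]
  | or f g ihf ihg => simp [eval, ihf h.1, ihg h.2]

theorem eval_subst (b : Bool) (f : XExpr) (x : List Bool) (ys : List (List Bool)) :
    (f.subst b).eval (x :: ys) = f.eval ((b :: x) :: ys) := by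
  induction f with
  | var i j => rcases i with _ | i <;> rcases j with _ | j <;> simp [subst, eval]
  | _ => simp_all [subst, eval]

/-- Being an equivalence, this also carries ill-formedness through the game. The check can thus wait
until blocks are exhausted, where an illegal variable shows up as one of a block that no longer
exists. -/
theorem wf_subst (b : Bool) (f : XExpr) (m : ℕ) (ms : List ℕ) :
    (f.subst b).WF (m :: ms) ↔ f.WF ((m + 1) :: ms) := by
  induction f with
  | var i j => rcases i with _ | i <;> rcases j with _ | j <;> simp [subst, WF]
  | _ => simp_all [subst, WF]

theorem eval_shift (f : XExpr) (ys : List (List Bool)) : f.shift.eval ys = f.eval ([] :: ys) := by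
  induction f with
  | var i j => rcases i with _ | i <;> simp [shift, eval]
  | _ => simp_all [shift, eval]

/-- What is pushed on the stack of errors when the exhausted first block is removed. -/
def shiftErrors : XExpr → List Bool
  | const _ => []
  | var 0 _ => [true]
  | var (_ + 1) _ => []
  | neg f => f.shiftErrors
  | and f g => g.shiftErrors ++ f.shiftErrors
  | or f g => g.shiftErrors ++ f.shiftErrors

/-- The tokens that result when the exhausted first block is removed. -/
def shiftToks : XExpr → List Tok
  | const c => [(true, false, c)]
  | var 0 j => bitToks (unary j)
  | var (i + 1) j => (var i j).toks
  | neg f => (false, false, false) :: f.shiftToks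
  | and f g => (false, false, true) :: (f.shiftToks ++ g.shiftToks)
  | or f g => (false, true, false) :: (f.shiftToks ++ g.shiftToks)

/-- What is pushed on the stack of errors when an expression is evaluated. -/
def varErrors : XExpr → List Bool
  | const _ => []
  | var _ _ => [true]
  | neg f => f.varErrors
  | and f g => f.varErrors ++ g.varErrors
  | or f g => f.varErrors ++ g.varErrors

/-- The pass leaves stray tokens only at a variable of the exhausted block, and there it also
records an error. -/
theorem shiftToks_eq (f : XExpr) (h : f.shiftErrors = []) : f.shiftToks = f.shift.toks := by
  induction f with
  | var i j => rcases i with _ | i <;> simp_all [shiftErrors, shiftToks, shift]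
  | _ => simp_all [shiftErrors, shiftToks, shift, toks]

theorem wf_zero_cons (f : XExpr) (ms : List ℕ) :
    f.WF (0 :: ms) ↔ f.shiftErrors = [] ∧ f.shift.WF ms := by
  induction f with
  | var i j => rcases i with _ | i <;> simp [shiftErrors, shift, WF]
  | and f g ihf ihg => simp [shiftErrors, shift, WF, ihf, ihg]; tauto
  | or f g ihf ihg => simp [shiftErrors, shift, WF, ihf, ihg]; tauto
  | _ => simp_all [shiftErrors, shift, WF]

theorem wf_nil (f : XExpr) : f.WF [] ↔ f.varErrors = [] := by
  induction f <;> simp_all [varErrors, WF]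

theorem length_toks_subst_le (b : Bool) (f : XExpr) :
    (f.subst b).toks.length ≤ f.toks.length := by
  induction f with
  | var i j =>
    rcases i with _ | i <;> rcases j with _ | j <;> simp [subst, toks, bitToks, unary]
  | _ => simp [subst, toks] at * <;> omega

theorem length_shiftToks_le (f : XExpr) : f.shiftToks.length ≤ f.toks.length := by
  induction f with
  | var i j =>
    rcases i with _ | i <;> simp [shiftToks, toks, bitToks, unary]
  | _ => simp [shiftToks, toks] at * <;> omega

end XExpr

/-- The bits for a token in the encoding of an expression, constants being expressed by the first
variable. -/
def Tok.bits : Tok → List Bool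
  | (false, a, b) => [a, b]
  | (true, true, b) => [b]
  | (true, false, true) => (XExpr.const true).toBool.encode
  | (true, false, false) => (XExpr.const false).toBool.encode

theorem Tok.flatMap_bits_bitToks (l : List Bool) : (bitToks l).flatMap Tok.bits = l := by
  induction l with
  | nil => rfl
  | cons b l ih => simpa [bitToks, Tok.bits] using ih

theorem XExpr.encode_toBool (f : XExpr) : f.toBool.encode = f.toks.flatMap Tok.bits := by
  induction f with
  | const c => cases c <;> simp [toks, Tok.bits]
  | var i j =>
    simp [toks, toBool, BoolExpr.encode, Tok.bits, Tok.flatMap_bits_bitToks]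
  | _ => simp_all [toks, toBool, BoolExpr.encode, Tok.bits]

/-- An answer of `VALₙ` is an optimal first bit. -/
theorem sat_subst_of_mem_VAL {n d m : ℕ} {ms : List ℕ} {E : XExpr} {b : Bool} {w : Word}
    (hE : E.WF ((m + 1) :: ms)) (hms : ∀ m ∈ ms, 1 ≤ m) (hn : ms.length + 1 + d = n)
    (hw : w.1 = ((m + 1) :: ms ++ List.replicate d 1).flatMap unary ++ E.toks.flatMap Tok.bits)
    (hb : b ∈ (VAL n w : Set Bool)) :
    Sat ((m + 1) :: ms) E.eval ↔ Sat (m :: ms) (E.subst b).eval := by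
  -- The query word encodes this function: the remaining blocks, padded to `n` blocks, and the
  -- expression with its constants eliminated.
  let I : Instance n :=
    { sizes := (m + 1) :: ms ++ List.replicate d 1
      expr := E.toBool
      length_sizes := by simp; omega
      one_le_sizes := by
        intro k hk
        simp only [List.cons_append, List.mem_cons, List.mem_append, List.mem_replicate] at hk
        rcases hk with rfl | hk | hk
        · omega
        · exact hms k hk
        · omega
      wellFormed := E.wf_toBool hE }
  have hfn : I.fn = E.eval := funext fun ys => E.eval_toBool ys
  have hI : I.encode = w.1 := by rw [hw, ← XExpr.encode_toBool]; rfl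
  rw [VAL_encode I w hI] at hb
  have hsat : Sat I.sizes I.fn ↔ Sat ((m + 1) :: ms) E.eval := by
    rw [hfn]
    exact (sat_coSat_append_replicate fun ys zs hys => E.eval_append hE ys zs hys).1
  constructor
  · intro h
    have h' : n ≠ 0 ∧ Sat I.sizes I.fn := ⟨by omega, hsat.2 h⟩
    rw [Instance.val, dif_pos h'] at hb
    obtain ⟨x, ⟨hx, hc⟩, hxb⟩ := hb
    obtain ⟨y, rfl⟩ : ∃ y, x = b :: y := by
      cases x with
      | nil => simp at hxb
      | cons a y => exact ⟨y, by simpa using hxb⟩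
    refine ⟨y, by simpa using hx, ?_⟩
    rw [hfn] at hc
    have := (sat_coSat_append_replicate (ms := ms) (d := d) (f := fun ys => E.eval ((b :: y) :: ys))
      fun ys zs hys => E.eval_append hE (_ :: ys) zs (by simp [hys])).2.1 hc
    simpa only [E.eval_subst] using this
  -- This direction does not use the oracle: a witness for the restricted function extends by `b`.
  -- So answers on unsatisfiable functions do no harm.
  · rintro ⟨y, hy, hc⟩
    refine ⟨b :: y, by simp [hy], ?_⟩
    simpa only [E.eval_subst] using hc

/-- The empty word is the only choice for a block of size zero. What is left begins with a universal
quantifier, and duality turns it into a negated existential question. -/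
theorem sat_zero_cons {ms : List ℕ} {E : XExpr} :
    Sat (0 :: ms) E.eval ↔ ¬ Sat ms (XExpr.neg E.shift).eval := by
  have h : Sat (0 :: ms) E.eval ↔ CoSat ms E.shift.eval := by
    have e : E.shift.eval = fun ys => E.eval ([] :: ys) := funext E.eval_shift
    rw [e]
    simp only [Sat, List.length_eq_zero_iff, exists_eq_left]
  rw [h]
  have := (sat_coSat_not (ms := ms) (f := E.shift.eval)).1
  change _ ↔ ¬ Sat ms fun ys => !E.shift.eval ys
  rw [this, not_not]

end PromiseHierarchy

namespace PromiseHierarchy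

/-! ### Programs on named stacks -/

/-- The stacks of the programs below. -/
inductive Stk : Type
  | inp | qry | hdr | tmp | body | aux | bad | val | grd | rnd | out
  deriving DecidableEq

instance : Fintype Stk where
  elems := {.inp, .qry, .hdr, .tmp, .body, .aux, .bad, .val, .grd, .rnd, .out}
  complete k := by cases k <;> decide

/-- The contents of the stacks. -/
@[ext]
structure Store : Type where
  inp : List Bool
  qry : List Bool
  hdr : List Bool
  tmp : List Bool
  body : List Bool
  aux : List Bool
  bad : List Bool
  val : List Bool
  grd : List Bool
  rnd : List Bool
  out : List Bool

namespace Store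

/-- The contents of a stack. -/
def get (S : Store) : Stk → List Bool
  | .inp => S.inp
  | .qry => S.qry
  | .hdr => S.hdr
  | .tmp => S.tmp
  | .body => S.body
  | .aux => S.aux
  | .bad => S.bad
  | .val => S.val
  | .grd => S.grd
  | .rnd => S.rnd
  | .out => S.out

/-- Replace the contents of a stack. -/
def set (S : Store) (k : Stk) (l : List Bool) : Store :=
  match k with
  | .inp => { S with inp := l }
  | .qry => { S with qry := l }
  | .hdr => { S with hdr := l }
  | .tmp => { S with tmp := l }
  | .body => { S with body := l }
  | .aux => { S with aux := l }
  | .bad => { S with bad := l }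
  | .val => { S with val := l }
  | .grd => { S with grd := l }
  | .rnd => { S with rnd := l }
  | .out => { S with out := l }

theorem get_set (S : Store) (k : Stk) (l : List Bool) :
    (S.set k l).get = Function.update S.get k l := by
  funext j
  cases k <;> cases j <;> rfl

theorem get_set_self (S : Store) (k : Stk) (l : List Bool) : (S.set k l).get k = l := by
  rw [get_set, Function.update_self]

theorem get_set_of_ne (S : Store) {k j : Stk} (h : j ≠ k) (l : List Bool) :
    (S.set k l).get j = S.get j := by
  rw [get_set, Function.update_of_ne h]

theorem get_injective : Function.Injective get := by
  intro S T h
  have h' (k) := congrFun h k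
  ext1
  exacts [h' .inp, h' .qry, h' .hdr, h' .tmp, h' .body, h' .aux, h' .bad, h' .val, h' .grd, h' .rnd,
    h' .out]

theorem set_set (S : Store) (k : Stk) (l l' : List Bool) : (S.set k l).set k l' = S.set k l' := by
  cases k <;> rfl

theorem set_get (S : Store) (k : Stk) : S.set k (S.get k) = S := by
  cases k <;> rfl

theorem set_comm (S : Store) {k j : Stk} (h : j ≠ k) (l l' : List Bool) :
    (S.set k l).set j l' = (S.set j l').set k l := by
  apply get_injective
  simp only [get_set]
  exact Function.update_comm h.symm _ _ _

end Store

/-- Timed correctness of a program on named stacks, queries being asked from the stack `qry`. -/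
def Exec (φ : PromiseProblem) (p : Prog Stk) (S : Store) (t : ℕ) (Q : Store → Prop) : Prop :=
  Runs .qry φ p S.get t fun s => ∃ S', s = Store.get S' ∧ Q S'

section Exec

variable {φ : PromiseProblem} {p p' : Prog Stk} {S S' : Store} {t u c : ℕ} {Q R : Store → Prop}
  {k j : Stk} {b : Bool} {l : List Bool}

theorem Exec.mono (h : Exec φ p S t Q) (htu : t ≤ u) : Exec φ p S u Q := Runs.mono h htu

theorem Exec.imp (h : Exec φ p S t Q) (hQ : ∀ S', Q S' → R S') : Exec φ p S t R :=
  Runs.imp h fun _ ⟨S', e, hS⟩ => ⟨S', e, hQ S' hS⟩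

/-- Stated as an equivalence, like the rules for the other elementary operations, so that
straight-line code can be executed by rewriting. -/
theorem exec_skip : Exec φ .skip S (t + 1) Q ↔ Q S := by
  constructor
  · rintro (⟨S', e, h⟩)
    rwa [Store.get_injective e]
  · exact fun h => .skip ⟨S, rfl, h⟩

theorem exec_push : Exec φ (.push k b p) S (t + 1) Q ↔ Exec φ p (S.set k (b :: S.get k)) t Q := by
  unfold Exec
  rw [Store.get_set]
  exact ⟨fun h => by cases h; assumption, .push⟩

theorem exec_pop {p : Option Bool → Prog Stk} :
    Exec φ (.pop k p) S (t + 1) Q ↔ Exec φ (p (S.get k).head?) (S.set k (S.get k).tail) t Q := by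
  unfold Exec
  rw [Store.get_set]
  exact ⟨fun h => by cases h; assumption, .pop⟩

theorem Exec.seq (h : Exec φ p S t R) (h' : ∀ S', R S' → Exec φ p' S' u Q) :
    Exec φ (.seq p p') S (t + u) Q :=
  Runs.seq _ h fun _ ⟨S', e, hS⟩ => e ▸ h' S' hS

theorem Exec.seq_eq (h : Exec φ p S t (· = S')) (h' : Exec φ p' S' u Q) :
    Exec φ (.seq p p') S (t + u) Q :=
  h.seq fun _ e => e ▸ h'

theorem Exec.loop_nil {p : Bool → Prog Stk} (hS : S.get k = []) (h : Q S) :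
    Exec φ (.loop k p) S (t + 1) Q :=
  Runs.loop_nil hS ⟨S, rfl, h⟩

theorem Exec.loop_cons {p : Bool → Prog Stk} (hS : S.get k = b :: l)
    (h : Exec φ (p b) (S.set k l) t R) (h' : ∀ S', R S' → Exec φ (.loop k p) S' u Q) :
    Exec φ (.loop k p) S (t + u + 1) Q := by
  unfold Exec at h
  rw [Store.get_set] at h
  exact Runs.loop_cons hS _ h fun _ ⟨S', e, hS⟩ => e ▸ h' S' hS

theorem Exec.ask {p : Bool → Prog Stk} (w : Word) (hw : S.qry = w.1)
    (h : ∀ b ∈ (φ w : Set Bool), Exec φ (p b) { S with qry := [] } t Q) :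
    Exec φ (.ask p) S (t + 1) Q := by
  refine Runs.ask w hw fun b hb => ?_
  have := h b hb
  unfold Exec at this
  rwa [show ({ S with qry := [] } : Store) = S.set .qry [] from rfl, Store.get_set] at this

end Exec

/-- The bits of a token. -/
def Tok.code (t : Tok) : List Bool := [t.1, t.2.1, t.2.2]

/-- A list of tokens as a list of bits. -/
def enc (ts : List Tok) : List Bool := ts.flatMap Tok.code

theorem enc_nil : enc [] = [] := rfl

theorem enc_cons (t : Tok) (ts : List Tok) :
    enc (t :: ts) = t.1 :: t.2.1 :: t.2.2 :: enc ts := rfl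

theorem enc_append (ts ts' : List Tok) : enc (ts ++ ts') = enc ts ++ enc ts' := by
  simp [enc]

namespace Prog

/-- Push a list, its head on top. -/
def pushL (k : Stk) : List Bool → Prog Stk → Prog Stk
  | [], p => p
  | b :: l, p => pushL k l (push k b p)

/-- Push a token. -/
def pushTok (k : Stk) (t : Tok) (p : Prog Stk) : Prog Stk :=
  push k t.2.2 (push k t.2.1 (push k t.1 p))

/-- Pop a token. -/
def popTok (k : Stk) (p : Tok → Prog Stk) : Prog Stk :=
  pop k fun a => pop k fun b => pop k fun c => p (a.getD false, b.getD false, c.getD false)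

/-- Pop and process tokens as long as there are any. -/
def loopTok (k : Stk) (p : Tok → Prog Stk) : Prog Stk :=
  loop k fun a => pop k fun b => pop k fun c => p (a, b.getD false, c.getD false)

/-- Move a stack onto another. -/
def move (k j : Stk) : Prog Stk := loop k fun b => push j b skip

/-- Move a stack of tokens onto another. -/
def moveTok (k j : Stk) : Prog Stk := loopTok k fun t => pushTok j t skip

end Prog

section Exec

variable {φ : PromiseProblem} {p : Prog Stk} {S S' : Store} {t u c : ℕ} {Q R : Store → Prop}
  {k j : Stk} {b : Bool} {l : List Bool}

theorem Exec.pushL (h : Exec φ p (S.set k (l ++ S.get k)) u Q) :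
    Exec φ (.pushL k l p) S (u + l.length) Q := by
  induction l generalizing p u with
  | nil => rw [List.nil_append, Store.set_get] at h; exact h
  | cons b l ih =>
    have : Exec φ (.push k b p) (S.set k (l ++ S.get k)) (u + 1) Q := by
      rw [exec_push, Store.set_set, Store.get_set_self]
      exact h
    exact (ih this).mono (by simp only [List.length_cons]; omega)

theorem exec_pushTok {t : Tok} : Exec φ (.pushTok k t p) S (u + 3) Q ↔
    Exec φ p (S.set k (t.1 :: t.2.1 :: t.2.2 :: S.get k)) u Q := by
  unfold Prog.pushTok
  rw [exec_push, exec_push, exec_push]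
  simp only [Store.set_set, Store.get_set_self]

theorem exec_popTok {p : Tok → Prog Stk} {t : Tok} (h : S.get k = t.1 :: t.2.1 :: t.2.2 :: l) :
    Exec φ (.popTok k p) S (u + 3) Q ↔ Exec φ (p t) (S.set k l) u Q := by
  unfold Prog.popTok
  rw [exec_pop, exec_pop, exec_pop]
  simp [Store.set_set, Store.get_set_self, h]

theorem Exec.loopTok_nil {p : Tok → Prog Stk} (hS : S.get k = []) (h : Q S) :
    Exec φ (.loopTok k p) S (t + 1) Q :=
  .loop_nil hS h

theorem Exec.loopTok_cons {p : Tok → Prog Stk} {t : Tok}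
    (hS : S.get k = t.1 :: t.2.1 :: t.2.2 :: l) (h : Exec φ (p t) (S.set k l) c R)
    (h' : ∀ S', R S' → Exec φ (.loopTok k p) S' u Q) :
    Exec φ (.loopTok k p) S (u + (c + 3)) Q := by
  refine (Exec.loop_cons (t := c + 2) hS (R := R) ?_ h').mono (by omega)
  rw [exec_pop, exec_pop]
  simpa [Store.set_set, Store.get_set_self] using h

theorem Exec.move (hkj : k ≠ j) (n : ℕ) (hn : (S.get k).length ≤ n) :
    Exec φ (.move k j) S (3 * n + 1)
      (· = (S.set k []).set j ((S.get k).reverse ++ S.get j)) := by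
  induction n generalizing S with
  | zero =>
    have hk : S.get k = [] := by simpa using hn
    have e : S.set k [] = S := by rw [← hk, Store.set_get]
    refine .loop_nil hk ?_
    rw [e, hk, List.reverse_nil, List.nil_append, Store.set_get]
  | succ n ih =>
    rcases hk : S.get k with _ | ⟨b, l⟩
    · have e : S.set k [] = S := by rw [← hk, Store.set_get]
      refine .loop_nil hk ?_
      rw [e, List.reverse_nil, List.nil_append, Store.set_get]
    · refine (Exec.loop_cons (t := 2) (u := 3 * n + 1) hk
        (R := (· = (S.set k l).set j (b :: S.get j))) ?_ ?_).mono (by omega)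
      · rw [exec_push, exec_skip, Store.get_set_of_ne _ hkj.symm]
      · rintro _ rfl
        refine (ih ?_).imp ?_
        · rw [Store.get_set_of_ne _ hkj, Store.get_set_self]
          simpa [hk] using hn
        · rintro _ rfl
          rw [Store.get_set_of_ne _ hkj, Store.get_set_self, Store.get_set_self,
            Store.set_comm (k := j) (j := k) _ hkj, Store.set_set, Store.set_set]
          simp

theorem Exec.moveTok (hkj : k ≠ j) (ts ts' : List Tok) (hk : S.get k = enc ts)
    (hj : S.get j = enc ts') :
    Exec φ (.moveTok k j) S (7 * ts.length + 1)
      (· = (S.set k []).set j (enc (ts.reverse ++ ts'))) := by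
  induction ts generalizing S ts' with
  | nil =>
    refine .loopTok_nil hk ?_
    have : S.set k [] = S := by rw [← enc_nil, ← hk, Store.set_get]
    rw [this, List.reverse_nil, List.nil_append, ← hj, Store.set_get]
  | cons t ts ih =>
    refine (Exec.loopTok_cons (c := 4) (u := 7 * ts.length + 1) (hk.trans (enc_cons _ _))
      (R := (· = (S.set k (enc ts)).set j (enc (t :: ts')))) ?_ ?_).mono
      (by simp only [List.length_cons]; omega)
    · rw [exec_pushTok, exec_skip, Store.get_set_of_ne _ hkj.symm, hj, enc_cons]
    · rintro _ rfl
      refine (ih (ts' := t :: ts') ?_ ?_).imp ?_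
      · rw [Store.get_set_of_ne _ hkj, Store.get_set_self]
      · rw [Store.get_set_self]
      · rintro _ rfl
        rw [Store.set_comm (k := j) (j := k) _ hkj, Store.set_set, Store.set_set]
        simp

end Exec

end PromiseHierarchy

namespace PromiseHierarchy

/-! ### Passes over the tokens of an expression -/

namespace Prog

/-- Copy the tokens of the stack `body` to `aux`, with `g` executed at every variable. -/
def pass (g : Prog Stk) : Prog Stk :=
  loopTok .body fun t => if t = (false, true, true) then g else pushTok .aux t skip

/-- Fix the first variable of the first block to `b`. -/
def substPass (b : Bool) : Prog Stk :=
  pass <| popTok .body fun t =>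
    if t = (true, true, false) then
      popTok .body fun t' =>
        if t' = (true, true, false) then pushTok .aux (true, false, b) skip
        else pushTok .aux (false, true, true) (pushTok .aux t skip)
    else pushTok .aux (false, true, true) (pushTok .aux t skip)

/-- Remove the exhausted first block. -/
def shiftPass : Prog Stk :=
  pass <| popTok .body fun t =>
    if t = (true, true, false) then push .bad true skip else pushTok .aux (false, true, true) skip

/-- Evaluate the expression with reversed tokens on `aux`, all variables being false. -/
def evalPass : Prog Stk :=
  loopTok .aux fun
    | (true, true, _) => skip
    | (true, false, c) => push .val c skip
    | (false, true, true) => push .bad true (push .val false skip)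
    | (false, false, false) => pop .val fun x => push .val (!x.getD false) skip
    | (false, false, true) => pop .val fun x => pop .val fun y =>
        push .val (x.getD false && y.getD false) skip
    | (false, true, false) => pop .val fun x => pop .val fun y =>
        push .val (x.getD false || y.getD false) skip

end Prog

-- Correctness and running time of the passes

variable {φ : PromiseProblem} {S : Store} {u : ℕ} {Q : Store → Prop}

/-- Twenty steps per token is a generous common rate for all passes, chosen so that the costs of
subexpressions simply add up. -/
theorem exec_pass_cons {g : Prog Stk} {t : Tok} (ht : t ≠ (false, true, true)) {r A : List Tok}
    (h : Exec φ (.pass g) { S with body := enc r, aux := enc (t :: A) } u Q) :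
    Exec φ (.pass g) { S with body := enc (t :: r), aux := enc A } (u + 20) Q := by
  refine Exec.mono (Exec.loopTok_cons (t := t) (l := enc r) rfl (c := 4) (u := u)
    (R := (· = { S with body := enc r, aux := enc (t :: A) })) ?_ ?_) (by omega)
  · simp [ht, exec_pushTok, exec_skip, Store.set, Store.get, enc_cons]
  · rintro _ rfl
    exact h

theorem exec_pass_var {g : Prog Stk} {r A : List Tok} (S' : Store)
    (hg : Exec φ g { S with body := enc r, aux := enc A } 15 (· = S'))
    (h : Exec φ (.pass g) S' u Q) :
    Exec φ (.pass g) { S with body := enc ((false, true, true) :: r), aux := enc A }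
      (u + 18) Q := by
  refine Exec.loopTok_cons (t := (false, true, true)) (l := enc r) rfl (c := 15) (R := (· = S'))
    ?_ ?_
  · simpa [Store.set] using hg
  · rintro _ rfl
    exact h

theorem exec_pass_bitToks {g : Prog Stk} (l : List Bool) {r A : List Tok}
    (h : Exec φ (.pass g) { S with body := enc r, aux := enc ((bitToks l).reverse ++ A) } u Q) :
    Exec φ (.pass g) { S with body := enc (bitToks l ++ r), aux := enc A }
      (u + 20 * l.length) Q := by
  induction l generalizing A with
  | nil => exact h
  | cons b l ih =>
    refine Exec.mono (exec_pass_cons (by simp) (ih (A := (true, true, b) :: A) ?_))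
      (by simp only [List.length_cons]; omega)
    simpa [bitToks] using h

theorem length_bitToks (l : List Bool) : (bitToks l).length = l.length := by simp [bitToks]

theorem unary_succ (k : ℕ) : unary (k + 1) = true :: unary k := rfl

/-- The induction is in continuation style: `r` is what follows the expression, `A` is what has
already been copied in reverse, and `h` is the run on the rest. For a binary operator the hypotheses
for its two arguments are chained. At a variable only its first one or two index bits decide: block
0 and index 0 give the constant, and for block 0 with a positive index one bit of the index is
dropped. All remaining bits are copied like ordinary tokens. -/
theorem exec_substPass_loop (b : Bool) (E : XExpr) (r A : List Tok)
    (h : Exec φ (.substPass b)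
      { S with body := enc r, aux := enc ((E.subst b).toks.reverse ++ A) } u Q) :
    Exec φ (.substPass b) { S with body := enc (E.toks ++ r), aux := enc A }
      (u + 20 * E.toks.length) Q := by
  induction E generalizing r A u with
  | const c => exact exec_pass_cons (by simp) h
  | var i j =>
    rcases i with _ | i
    · rcases j with _ | j
      · have h' : Exec φ (.substPass b) { S with
            body := enc ((false, true, true) :: (bitToks [false, false] ++ r))
            aux := enc A } (u + (15 + 3)) Q := by
          refine exec_pass_var
            { S with body := enc r, aux := enc ((true, false, b) :: A) } ?_ ?_
          · simp [bitToks, exec_popTok (t := (true, true, false)), exec_pushTok, exec_skip,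
              Store.set, Store.get, enc_cons]
          · exact h
        exact h'.mono (by simp [XExpr.toks, length_bitToks, unary])
      · have h' : Exec φ (.substPass b) { S with
            body := enc ((false, true, true) :: (bitToks (false :: true :: unary j) ++ r))
            aux := enc A } (u + 20 * (unary j).length + (15 + 3)) Q := by
          refine exec_pass_var
            { S with body := enc (bitToks (unary j) ++ r)
                     aux := enc ((true, true, false) :: (false, true, true) :: A) } ?_ ?_
          · simp [bitToks, exec_popTok (t := (true, true, false)),
              exec_popTok (t := (true, true, true)), exec_pushTok, exec_skip,
              Store.set, Store.get, enc_cons]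
          · refine exec_pass_bitToks (unary j) ?_
            change Exec φ (.substPass b) _ u Q
            simpa [XExpr.subst, XExpr.toks, bitToks, unary] using h
        exact h'.mono (by simp [XExpr.toks, length_bitToks, unary]; omega)
    · have h' : Exec φ (.substPass b) { S with
          body := enc ((false, true, true) :: (bitToks (true :: unary i ++ unary j) ++ r))
          aux := enc A } (u + 20 * (unary i ++ unary j).length + (15 + 3)) Q := by
        refine exec_pass_var
            { S with body := enc (bitToks (unary i ++ unary j) ++ r)
                     aux := enc ((true, true, true) :: (false, true, true) :: A) } ?_ ?_
        · simp [bitToks, exec_popTok (t := (true, true, true)), exec_pushTok, exec_skip,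
            Store.set, Store.get, enc_cons]
        · refine exec_pass_bitToks (unary i ++ unary j) ?_
          change Exec φ (.substPass b) _ u Q
          simpa [XExpr.subst, XExpr.toks, bitToks, unary_succ] using h
      exact h'.mono (by simp [XExpr.toks, length_bitToks, unary]; omega)
  | neg f ih =>
    refine Exec.mono (exec_pass_cons (by simp) (ih (u := u) r ((false, false, false) :: A) ?_))
      (by simp only [XExpr.toks, List.length_cons]; omega)
    simpa [XExpr.subst, XExpr.toks] using h
  | and f g ihf ihg =>
    simp only [XExpr.toks, List.cons_append, List.append_assoc]
    refine Exec.mono (exec_pass_cons (by simp)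
      (ihf _ ((false, false, true) :: A) (ihg (u := u) r _ ?_)))
      (by simp only [List.length_cons, List.length_append]; omega)
    simpa [XExpr.subst, XExpr.toks] using h
  | or f g ihf ihg =>
    simp only [XExpr.toks, List.cons_append, List.append_assoc]
    refine Exec.mono (exec_pass_cons (by simp)
      (ihf _ ((false, true, false) :: A) (ihg (u := u) r _ ?_)))
      (by simp only [List.length_cons, List.length_append]; omega)
    simpa [XExpr.subst, XExpr.toks] using h

/-- Dropping the first bit of a block index lowers it by one. If that bit already ends the number,
the variable belongs to the exhausted block and an error is recorded. -/
theorem exec_shiftPass_loop (E : XExpr) (r A : List Tok) (B : List Bool)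
    (h : Exec φ .shiftPass { S with body := enc r
                                    aux := enc (E.shiftToks.reverse ++ A)
                                    bad := E.shiftErrors ++ B } u Q) :
    Exec φ .shiftPass { S with body := enc (E.toks ++ r), aux := enc A, bad := B }
      (u + 20 * E.toks.length) Q := by
  induction E generalizing r A B u with
  | const c => exact exec_pass_cons (S := { S with bad := B }) (by simp) h
  | var i j =>
    rcases i with _ | i
    · have h' : Exec φ .shiftPass { S with
          body := enc ((false, true, true) :: (bitToks (false :: unary j) ++ r))
          aux := enc A
          bad := B } (u + 20 * (unary j).length + (15 + 3)) Q := by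
        refine exec_pass_var (S := { S with bad := B })
            { S with body := enc (bitToks (unary j) ++ r), aux := enc A, bad := true :: B } ?_ ?_
        · simp [bitToks, exec_popTok (t := (true, true, false)), exec_push, exec_skip,
            Store.set, Store.get, enc_cons]
        · exact exec_pass_bitToks (S := { S with bad := true :: B }) (unary j) h
      exact h'.mono (by simp [XExpr.toks, length_bitToks, unary]; omega)
    · have h' : Exec φ .shiftPass { S with
          body := enc ((false, true, true) :: (bitToks (true :: unary i ++ unary j) ++ r))
          aux := enc A
          bad := B } (u + 20 * (unary i ++ unary j).length + (15 + 3)) Q := by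
        refine exec_pass_var (S := { S with bad := B })
            { S with body := enc (bitToks (unary i ++ unary j) ++ r)
                     aux := enc ((false, true, true) :: A), bad := B } ?_ ?_
        · simp [bitToks, exec_popTok (t := (true, true, true)), exec_pushTok, exec_skip,
            Store.set, Store.get, enc_cons]
        · refine exec_pass_bitToks (S := { S with bad := B }) (unary i ++ unary j) ?_
          change Exec φ .shiftPass _ u Q
          simpa [XExpr.shiftToks, XExpr.shiftErrors, XExpr.toks] using h
      exact h'.mono (by simp [XExpr.toks, length_bitToks, unary]; omega)
  | neg f ih =>
    refine Exec.mono (exec_pass_cons (S := { S with bad := B }) (by simp)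
      (ih (u := u) r ((false, false, false) :: A) B ?_))
      (by simp only [XExpr.toks, List.length_cons]; omega)
    simpa [XExpr.shiftToks, XExpr.shiftErrors] using h
  | and f g ihf ihg =>
    simp only [XExpr.toks, List.cons_append, List.append_assoc]
    refine Exec.mono (exec_pass_cons (S := { S with bad := B }) (by simp)
      (ihf _ ((false, false, true) :: A) B (ihg (u := u) r _ _ ?_)))
      (by simp only [List.length_cons, List.length_append]; omega)
    simpa [XExpr.shiftToks, XExpr.shiftErrors] using h
  | or f g ihf ihg =>
    simp only [XExpr.toks, List.cons_append, List.append_assoc]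
    refine Exec.mono (exec_pass_cons (S := { S with bad := B }) (by simp)
      (ihf _ ((false, true, false) :: A) B (ihg (u := u) r _ _ ?_)))
      (by simp only [List.length_cons, List.length_append]; omega)
    simpa [XExpr.shiftToks, XExpr.shiftErrors] using h

theorem exec_evalPass_bitToks (l : List Bool) {r : List Tok}
    (h : Exec φ .evalPass { S with aux := enc r } u Q) :
    Exec φ .evalPass { S with aux := enc ((bitToks l).reverse ++ r) } (u + 20 * l.length) Q := by
  induction l generalizing r u with
  | nil => exact h
  | cons b l ih =>
    have h' : Exec φ .evalPass { S with aux := enc ((true, true, b) :: r) } (u + 20) Q := by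
      refine Exec.mono (Exec.loopTok_cons (t := (true, true, b)) (l := enc r) rfl (c := 1) (u := u)
        (R := (· = { S with aux := enc r })) ?_ ?_) (by omega)
      · simp [exec_skip, Store.set]
      · rintro _ rfl
        exact h
    have := ih h'
    refine Exec.mono (t := u + 20 + 20 * l.length) ?_ (by simp only [List.length_cons]; omega)
    simpa [bitToks] using this

/-- Prefix notation read backwards is evaluated with a stack of values: both arguments have been
evaluated when their operator arrives, the first one on top. -/
theorem exec_evalPass_loop (E : XExpr) (r : List Tok) (B V : List Bool)
    (h : Exec φ .evalPass { S with aux := enc r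
                                   bad := E.varErrors ++ B
                                   val := E.eval [] :: V } u Q) :
    Exec φ .evalPass { S with aux := enc (E.toks.reverse ++ r), bad := B, val := V }
      (u + 20 * E.toks.length) Q := by
  induction E generalizing r B V u with
  | const c =>
    refine Exec.mono (Exec.loopTok_cons (t := (true, false, c)) (l := enc r) rfl (c := 2) (u := u)
      (R := (· = { S with aux := enc r, bad := B, val := c :: V })) ?_ ?_)
      (by simp [XExpr.toks])
    · simp [exec_push, exec_skip, Store.set, Store.get]
    · rintro _ rfl
      exact h
  | var i j =>
    have h' : Exec φ .evalPass
        { S with aux := enc ((false, true, true) :: r), bad := B, val := V } (u + 20) Q := by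
      refine Exec.mono (Exec.loopTok_cons (t := (false, true, true))
        (l := enc r) rfl (c := 3) (u := u)
        (R := (· = { S with aux := enc r, bad := true :: B, val := false :: V })) ?_ ?_)
        (by omega)
      · simp [exec_push, exec_skip, Store.set, Store.get]
      · rintro _ rfl
        exact h
    have := exec_evalPass_bitToks (S := { S with bad := B, val := V }) (unary i ++ unary j) h'
    refine Exec.mono (t := u + 20 + 20 * (unary i ++ unary j).length) ?_
      (by simp only [XExpr.toks, List.length_cons, length_bitToks]; omega)
    simpa [XExpr.toks] using this
  | neg f ih =>
    have h' : Exec φ .evalPass { S with aux := enc ((false, false, false) :: r)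
                                        bad := f.varErrors ++ B
                                        val := f.eval [] :: V } (u + 20) Q := by
      refine Exec.mono (Exec.loopTok_cons (t := (false, false, false))
        (l := enc r) rfl (c := 3) (u := u)
        (R := (· = { S with aux := enc r, bad := f.varErrors ++ B, val := (!f.eval []) :: V }))
        ?_ ?_) (by omega)
      · simp [exec_push, exec_pop, exec_skip, Store.set, Store.get]
      · rintro _ rfl
        exact h
    refine Exec.mono (t := u + 20 + 20 * f.toks.length) ?_
      (by simp only [XExpr.toks, List.length_cons]; omega)
    simpa [XExpr.toks] using ih _ B V h'
  | and f g ihf ihg =>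
    have h' : Exec φ .evalPass { S with aux := enc ((false, false, true) :: r)
                                        bad := f.varErrors ++ (g.varErrors ++ B)
                                        val := f.eval [] :: g.eval [] :: V } (u + 20) Q := by
      refine Exec.mono (Exec.loopTok_cons (t := (false, false, true))
        (l := enc r) rfl (c := 4) (u := u)
        (R := (· = { S with aux := enc r
                            bad := f.varErrors ++ (g.varErrors ++ B)
                            val := (f.eval [] && g.eval []) :: V })) ?_ ?_) (by omega)
      · simp [exec_push, exec_pop, exec_skip, Store.set, Store.get]
      · rintro _ rfl
        rw [XExpr.varErrors, List.append_assoc] at h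
        exact h
    refine Exec.mono (t := u + 20 + 20 * f.toks.length + 20 * g.toks.length) ?_
      (by simp only [XExpr.toks, List.length_cons, List.length_append]; omega)
    simpa [XExpr.toks] using ihg _ B V (ihf _ _ _ h')
  | or f g ihf ihg =>
    have h' : Exec φ .evalPass { S with aux := enc ((false, true, false) :: r)
                                        bad := f.varErrors ++ (g.varErrors ++ B)
                                        val := f.eval [] :: g.eval [] :: V } (u + 20) Q := by
      refine Exec.mono (Exec.loopTok_cons (t := (false, true, false))
        (l := enc r) rfl (c := 4) (u := u)
        (R := (· = { S with aux := enc r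
                            bad := f.varErrors ++ (g.varErrors ++ B)
                            val := (f.eval [] || g.eval []) :: V })) ?_ ?_) (by omega)
      · simp [exec_push, exec_pop, exec_skip, Store.set, Store.get]
      · rintro _ rfl
        rw [XExpr.varErrors, List.append_assoc] at h
        exact h
    refine Exec.mono (t := u + 20 + 20 * f.toks.length + 20 * g.toks.length) ?_
      (by simp only [XExpr.toks, List.length_cons, List.length_append]; omega)
    simpa [XExpr.toks] using ihg _ B V (ihf _ _ _ h')

end PromiseHierarchy

namespace PromiseHierarchy

/-! ### Parsing -/

namespace Prog

/-- The loop of `readUnary`, which runs as long as `grd` is not empty. -/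
def readUnaryLoop (dst : Stk) (em : Bool → List Bool) : Prog Stk :=
  loop .grd fun _ => pop .inp fun
    | none => push .bad true skip
    | some b => pushL dst (em b) (if b then push .grd true skip else skip)

/-- Read a unary number from the input and write its bits, encoded by `em`, on `dst`, the guard on
`grd` being set first. -/
def readUnary (dst : Stk) (em : Bool → List Bool) : Prog Stk :=
  push .grd true (readUnaryLoop dst em)

/-- Read `k` positive block sizes from the input, their reversed encoding being left on `tmp`. -/
def parseHeader : ℕ → Prog Stk
  | 0 => skip
  | k + 1 => pop .inp fun o =>
      if o = some true then
        push .tmp true <| seq (readUnary .tmp fun b => [b]) <| pop .bad fun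
          | none => parseHeader k
          | some _ => push .bad true skip
      else push .bad true skip

/-- The code of a bit of a unary number. -/
def bitCode (b : Bool) : List Bool := [true, true, b]

/-- Read as many expressions as there are bits on `val`, their reversed tokens being left on
`aux`. -/
def parseExprs : Prog Stk :=
  loop .val fun _ => pop .inp fun
    | none => push .bad true skip
    | some a => pop .inp fun
      | none => push .bad true skip
      | some b => pushTok .aux (false, a, b) <|
          match a, b with
          | false, false => push .val true skip
          | true, true => seq (readUnary .aux bitCode) (readUnary .aux bitCode)
          | false, true => push .val true (push .val true skip)
          | true, false => push .val true (push .val true skip)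

end Prog

-- Correctness and running time of the parser

variable {φ : PromiseProblem} {S : Store} {u : ℕ} {Q : Store → Prop}

/-- The guard stack holds one letter as long as another bit is expected; it is refilled by a 1 and
left empty by the final 0. The condition on `dst` keeps it apart from the stacks that control the
loop. -/
theorem exec_readUnaryLoop {dst : Stk} {em : Bool → List Bool} (hd : dst = .tmp ∨ dst = .aux)
    (hem : ∀ b, (em b).length ≤ 3) (i : ℕ) (r D : List Bool) :
    Exec φ (.readUnaryLoop dst em) (({ S with inp := unary i ++ r, grd := [true] }).set dst D)
      (10 * i + 15)
      (· = ({ S with inp := r, grd := [] }).set dst ((unary i).reverse.flatMap em ++ D)) := by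
  induction i generalizing D with
  | zero =>
    refine Exec.mono (t := ((1 + (em false).length) + 1) + 1 + 1) ?_
      (by have := hem false; omega)
    refine Exec.loop_cons (t := (1 + (em false).length) + 1) (u := 0 + 1) (b := true) (l := [])
      (by rcases hd with rfl | rfl <;> rfl)
      (R := (· = ({ S with inp := r, grd := [] }).set dst ((unary 0).reverse.flatMap em ++ D)))
      ?_ ?_
    · rw [exec_pop]
      rcases hd with rfl | rfl
      · refine Exec.pushL ?_
        simp [exec_skip, Store.set, Store.get, unary]
      · refine Exec.pushL ?_
        simp [exec_skip, Store.set, Store.get, unary]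
    · rintro _ rfl
      rcases hd with rfl | rfl <;> exact Exec.loop_nil rfl rfl
  | succ i ih =>
    refine Exec.mono (t := ((2 + (em true).length) + 1) + (10 * i + 15) + 1) ?_
      (by have := hem true; omega)
    refine Exec.loop_cons (b := true) (l := []) (by rcases hd with rfl | rfl <;> rfl)
      (R := (· = ({ S with inp := unary i ++ r, grd := [true] }).set dst (em true ++ D)))
      ?_ ?_
    · rw [exec_pop]
      rcases hd with rfl | rfl
      · refine Exec.pushL ?_
        simp [exec_push, exec_skip, Store.set, Store.get, unary_succ]
      · refine Exec.pushL ?_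
        simp [exec_push, exec_skip, Store.set, Store.get, unary_succ]
    · rintro _ rfl
      refine (ih _).imp ?_
      rintro _ rfl
      simp [unary_succ]

theorem exec_readUnaryLoop_fail {dst : Stk} {em : Bool → List Bool}
    (hd : dst = .tmp ∨ dst = .aux) (hem : ∀ b, (em b).length ≤ 3) (i : ℕ) (D : List Bool) :
    Exec φ (.readUnaryLoop dst em)
      (({ S with inp := List.replicate i true, grd := [true] }).set dst D) (10 * i + 15)
      (· = ({ S with inp := [], grd := [], bad := true :: S.bad }).set dst
        ((List.replicate i true).flatMap em ++ D)) := by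
  induction i generalizing D with
  | zero =>
    refine Exec.mono (t := 3 + (0 + 1) + 1) ?_ (by omega)
    refine Exec.loop_cons (t := 3) (u := 0 + 1) (b := true) (l := [])
      (by rcases hd with rfl | rfl <;> rfl)
      (R := (· = ({ S with inp := [], grd := [], bad := true :: S.bad }).set dst D)) ?_ ?_
    · rcases hd with rfl | rfl <;> simp [exec_pop, exec_push, exec_skip, Store.set, Store.get]
    · rintro _ rfl
      rcases hd with rfl | rfl <;> exact Exec.loop_nil rfl rfl
  | succ i ih =>
    refine Exec.mono (t := ((2 + (em true).length) + 1) + (10 * i + 15) + 1) ?_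
      (by have := hem true; omega)
    refine Exec.loop_cons (b := true) (l := []) (by rcases hd with rfl | rfl <;> rfl)
      (R := (· = ({ S with inp := List.replicate i true, grd := [true] }).set dst (em true ++ D)))
      ?_ ?_
    · rw [exec_pop]
      rcases hd with rfl | rfl
      · refine Exec.pushL ?_
        simp [exec_push, exec_skip, Store.set, Store.get, List.replicate_succ]
      · refine Exec.pushL ?_
        simp [exec_push, exec_skip, Store.set, Store.get, List.replicate_succ]
    · rintro _ rfl
      refine (ih _).imp ?_
      rintro _ rfl
      congr 1
      rw [List.replicate_succ', List.flatMap_append]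
      simp

/-- Either a 0 occurs, and the first one ends a unary number, or the input consists of 1s and
reading a number fails at its end. -/
theorem eq_unary_append_or (l : List Bool) :
    (∃ i r, l = unary i ++ r) ∨ ∃ i, l = List.replicate i true := by
  induction l with
  | nil => exact .inr ⟨0, rfl⟩
  | cons b l ih =>
    cases b with
    | false => exact .inl ⟨0, l, rfl⟩
    | true =>
      rcases ih with ⟨i, r, rfl⟩ | ⟨i, rfl⟩
      · exact .inl ⟨i + 1, r, rfl⟩
      · exact .inr ⟨i + 1, rfl⟩

theorem unary_append_ne_replicate (i j : ℕ) (r : List Bool) :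
    unary i ++ r ≠ List.replicate j true := by
  intro h
  have : false ∈ List.replicate j true := h ▸ by simp [unary]
  simp at this

theorem length_unary (i : ℕ) : (unary i).length = i + 1 := by simp [unary]

/-- A correct header at the beginning of `l`. -/
def HeaderOf (k : ℕ) (l : List Bool) (sizes : List ℕ) (r : List Bool) : Prop :=
  sizes.length = k ∧ (∀ m ∈ sizes, 1 ≤ m) ∧ l = sizes.flatMap unary ++ r

theorem exec_parseHeader (k : ℕ) (S : Store) (hbad : S.bad = []) (hgrd : S.grd = []) :
    Exec φ (.parseHeader k) S (20 * S.inp.length + 30 * k + 1) fun S' =>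
      (∃ sizes r, HeaderOf k S.inp sizes r ∧
        S' = { S with inp := r, tmp := (sizes.flatMap unary).reverse ++ S.tmp }) ∨
      ((¬ ∃ sizes r, HeaderOf k S.inp sizes r) ∧ S'.bad ≠ [] ∧ S'.out = S.out) := by
  induction k generalizing S with
  | zero =>
    refine exec_skip.2 (.inl ⟨[], S.inp, ⟨rfl, by simp, rfl⟩, ?_⟩)
    simp
  | succ k ih =>
    refine Exec.mono (t := (20 * S.inp.length + 30 * k + 30) + 1) ?_ (by omega)
    unfold Prog.parseHeader
    rw [exec_pop]
    have hfail : (¬ ∃ l, S.inp = true :: l) → ¬ ∃ sizes r, HeaderOf (k + 1) S.inp sizes r := by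
      rintro h ⟨sizes, r, hl, h1, he⟩
      rcases sizes with _ | ⟨m, sizes⟩
      · simp at hl
      -- A positive size is encoded with a leading 1, which is what the parser tests first.
      · obtain ⟨m, rfl⟩ : ∃ j, m = j + 1 := ⟨m - 1, by have := h1 m (by simp); omega⟩
        exact h ⟨_, he⟩
    rcases hinp : S.inp with _ | ⟨b, l⟩
    · have e : S.get .inp = [] := hinp
      simp only [e, List.head?_nil, reduceCtorEq, if_false]
      refine Exec.mono (t := 2) ?_ (by omega)
      rw [exec_push, exec_skip]
      refine .inr ⟨hinp ▸ hfail (by simp [hinp]), by simp [Store.set], rfl⟩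
    cases b with
    | false =>
      have e : S.get .inp = false :: l := hinp
      simp only [e, List.head?_cons, Option.some.injEq, Bool.false_eq_true, if_false]
      refine Exec.mono (t := 2) ?_ (by omega)
      rw [exec_push, exec_skip]
      refine .inr ⟨hinp ▸ hfail (by simp [hinp]), by simp [Store.set], rfl⟩
    | true =>
      have e : S.get .inp = true :: l := hinp
      simp only [e, List.head?_cons, if_true, List.tail_cons]
      rcases eq_unary_append_or l with ⟨i, r, rfl⟩ | ⟨i, rfl⟩
      · refine Exec.mono (t := (10 * i + 15 + 1) + (20 * r.length + 30 * k + 1 + 1) + 1) ?_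
          (by simp [length_unary]; omega)
        rw [exec_push]
        refine Exec.seq (R := (· = { S with inp := r, tmp := (unary (i + 1)).reverse ++ S.tmp }))
          ?_ ?_
        · rw [Prog.readUnary, exec_push]
          have := exec_readUnaryLoop (φ := φ) (S := S) (dst := .tmp) (em := fun b => [b])
            (.inl rfl) (by simp) i r (true :: S.tmp)
          simp only [Store.set, Store.get, hgrd] at this ⊢
          refine this.imp ?_
          rintro _ rfl
          simp [unary_succ]
        · rintro _ rfl
          rw [exec_pop]
          have e2 : Store.get { S with inp := r, tmp := (unary (i + 1)).reverse ++ S.tmp } .bad =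
            [] := hbad
          have e3 : ({ S with inp := r, tmp := (unary (i + 1)).reverse ++ S.tmp } : Store).set
            .bad [] = { S with inp := r, tmp := (unary (i + 1)).reverse ++ S.tmp } := by
            simp [Store.set, hbad]
          simp only [e2, List.head?_nil, List.tail_nil, e3]
          refine (ih { S with inp := r, tmp := (unary (i + 1)).reverse ++ S.tmp } hbad hgrd).imp ?_
          rintro S' (⟨sizes, r', ⟨hl, h1, he⟩, rfl⟩ | ⟨hno, hb, ho⟩)
          · refine .inl ⟨(i + 1) :: sizes, r', ⟨by simp [hl], ?_, ?_⟩, ?_⟩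
            · intro m hm
              rcases List.mem_cons.1 hm with rfl | hm
              · omega
              · exact h1 m hm
            · rw [List.flatMap_cons, List.append_assoc, ← he]
              rfl
            · simp
          · refine .inr ⟨?_, hb, ho⟩
            rintro ⟨sizes, r', hl, h1, he⟩
            rcases sizes with _ | ⟨m, sizes⟩
            · simp at hl
            · rw [List.flatMap_cons, List.append_assoc] at he
              have he' : unary (i + 1) ++ r = unary m ++ (sizes.flatMap unary ++ r') := he
              obtain ⟨rfl, rfl⟩ := unary_append_inj he'
              exact hno ⟨sizes, r', by simpa using hl,
                fun m hm => h1 m (List.mem_cons_of_mem _ hm), rfl⟩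
      -- The first block size never ends: the input consists of 1s, so the reader runs out of
      -- letters and records an error.
      · refine Exec.mono (t := (10 * i + 15 + 1) + (2 + 1) + 1) ?_ (by simp; omega)
        rw [exec_push]
        refine Exec.seq (t := 10 * i + 15 + 1) (u := 2 + 1)
          (R := fun S' => S'.bad ≠ [] ∧ S'.out = S.out) ?_ ?_
        · rw [Prog.readUnary, exec_push]
          have := exec_readUnaryLoop_fail (φ := φ) (S := S) (dst := .tmp) (em := fun b => [b])
            (.inl rfl) (by simp) i (true :: S.tmp)
          simp only [Store.set, Store.get, hgrd] at this ⊢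
          refine this.imp ?_
          rintro _ rfl
          simp
        · rintro S' ⟨hb, ho⟩
          rw [exec_pop]
          obtain ⟨b, B, hB⟩ := List.exists_cons_of_ne_nil hb
          have e2 : S'.get .bad = b :: B := hB
          simp only [e2, List.head?_cons]
          rw [exec_push, exec_skip]
          refine .inr ⟨?_, by simp [Store.set], by simpa [Store.set] using ho⟩
          rintro ⟨sizes, r', hl, h1, he⟩
          rcases sizes with _ | ⟨m, sizes⟩
          · simp at hl
          · rw [List.flatMap_cons, List.append_assoc] at he
            exact unary_append_ne_replicate m (i + 1) _ he.symm

/-- `c` expressions at the beginning of `l`. -/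
def ForestOf (c : ℕ) (l : List Bool) (es : List BoolExpr) (r : List Bool) : Prop :=
  es.length = c ∧ l = es.flatMap BoolExpr.encode ++ r

/-- The tokens of a list of expressions. -/
def forestToks (es : List BoolExpr) : List Tok := es.flatMap fun e => (XExpr.ofBool e).toks

/-- Every parsing failure leaves the input empty. The loop still runs once per pending expression,
and each of these rounds only adds an error. -/
theorem exec_parseExprs_nil (c : ℕ) (B : List Bool) :
    Exec φ .parseExprs { S with inp := [], val := List.replicate c true, bad := B } (5 * c + 1)
      fun S' => (B ≠ [] ∨ c ≠ 0 → S'.bad ≠ []) ∧ S'.out = S.out := by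
  induction c generalizing B with
  | zero => exact Exec.loop_nil rfl (by simp)
  | succ c ih =>
    refine Exec.mono (t := 3 + (5 * c + 1) + 1) ?_ (by omega)
    refine Exec.loop_cons (b := true) (l := List.replicate c true) rfl
      (R := (· = { S with inp := [], val := List.replicate c true, bad := true :: B })) ?_ ?_
    · simp [exec_pop, exec_push, exec_skip, Store.set, Store.get]
    · rintro _ rfl
      refine (ih (true :: B)).imp fun S' h => ⟨fun _ => h.1 (by simp), h.2⟩

theorem exec_readUnary_aux (i : ℕ) (r : List Bool) (A : List Tok) (hgrd : S.grd = []) :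
    Exec φ (.readUnary .aux Prog.bitCode) { S with inp := unary i ++ r, aux := enc A } (10 * i + 16)
      (· = { S with inp := r, aux := enc ((bitToks (unary i)).reverse ++ A) }) := by
  rw [Prog.readUnary, exec_push]
  have := exec_readUnaryLoop (φ := φ) (S := S) (dst := .aux) (em := Prog.bitCode)
    (.inr rfl) (by simp [Prog.bitCode]) i r (enc A)
  simp only [Store.set, Store.get, hgrd] at this ⊢
  refine this.imp ?_
  rintro _ rfl
  have : (unary i).reverse.flatMap Prog.bitCode = enc (bitToks (unary i)).reverse := by
    unfold bitToks
    rw [← List.map_reverse, enc, List.flatMap_map]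
    rfl
  rw [enc_append, this]

theorem exec_readUnary_aux_fail (i : ℕ) (A : List Bool) (hgrd : S.grd = []) :
    Exec φ (.readUnary .aux Prog.bitCode) { S with inp := List.replicate i true, aux := A }
      (10 * i + 16) fun S' => ∃ A', S' = { S with inp := [], aux := A', bad := true :: S.bad } := by
  rw [Prog.readUnary, exec_push]
  have := exec_readUnaryLoop_fail (φ := φ) (S := S) (dst := .aux) (em := Prog.bitCode)
    (.inr rfl) (by simp [Prog.bitCode]) i A
  simp only [Store.set, Store.get, hgrd] at this ⊢
  refine this.imp ?_
  rintro _ rfl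
  exact ⟨_, rfl⟩

theorem BoolExpr.encode_ne_nil (e : BoolExpr) : e.encode ≠ [] := by
  cases e <;> simp [BoolExpr.encode]

theorem BoolExpr.encode_ne_singleton (e : BoolExpr) (l : List Bool) (a : Bool) :
    e.encode ++ l ≠ [a] := by
  cases e <;> simp [BoolExpr.encode]

/-- The outcome of parsing `c` expressions from `l`. -/
def ParseOutcome (S : Store) (c : ℕ) (l : List Bool) (A : List Tok) (S' : Store) : Prop :=
  (∃ es r, ForestOf c l es r ∧
    S' = { S with inp := r, val := [], aux := enc ((forestToks es).reverse ++ A) }) ∨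
  ((¬ ∃ es r, ForestOf c l es r) ∧ S'.bad ≠ [] ∧ S'.out = S.out)

theorem ForestOf.cons {c : ℕ} {l r : List Bool} {es : List BoolExpr}
    (h : ForestOf (c + 1) l es r) :
    ∃ e es', es = e :: es' ∧ es'.length = c ∧
      l = e.encode ++ (es'.flatMap BoolExpr.encode ++ r) := by
  obtain ⟨hl, rfl⟩ := h
  rcases es with _ | ⟨e, es⟩
  · simp at hl
  · exact ⟨e, es, rfl, by simpa using hl, by simp⟩

/-- A negation replaces one pending expression by one, a binary operator by two, and a variable by
none. Together with the unambiguity of the notation this reduces both success and failure to the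
shorter input. -/
theorem ParseOutcome.neg {c : ℕ} {l : List Bool} {A : List Tok} {S' : Store}
    (h : ParseOutcome S (c + 1) l ((false, false, false) :: A) S') :
    ParseOutcome S (c + 1) (false :: false :: l) A S' := by
  rcases h with ⟨es, r, hf, rfl⟩ | ⟨hno, h⟩
  · obtain ⟨e, es, rfl, hl, rfl⟩ := hf.cons
    exact .inl ⟨.neg e :: es, r, ⟨by simp [hl], by simp [BoolExpr.encode]⟩,
      by simp [forestToks, XExpr.ofBool, XExpr.toks]⟩
  · refine .inr ⟨?_, h⟩
    rintro ⟨es, r, hf⟩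
    obtain ⟨e, es, rfl, hl, he⟩ := hf.cons
    rcases e with _ | e | _ | _ <;> simp [BoolExpr.encode] at he
    exact hno ⟨e :: es, r, by simp [hl], by simp [he]⟩

theorem ParseOutcome.and {c : ℕ} {l : List Bool} {A : List Tok} {S' : Store}
    (h : ParseOutcome S (c + 2) l ((false, false, true) :: A) S') :
    ParseOutcome S (c + 1) (false :: true :: l) A S' := by
  rcases h with ⟨es, r, hf, rfl⟩ | ⟨hno, h⟩
  · obtain ⟨e, es, rfl, hl, rfl⟩ := hf.cons
    rcases es with _ | ⟨e', es⟩
    · simp at hl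
    exact .inl ⟨.and e e' :: es, r, ⟨by simpa using hl, by simp [BoolExpr.encode]⟩,
      by simp [forestToks, XExpr.ofBool, XExpr.toks]⟩
  · refine .inr ⟨?_, h⟩
    rintro ⟨es, r, hf⟩
    obtain ⟨e, es, rfl, hl, he⟩ := hf.cons
    rcases e with _ | _ | ⟨e, e'⟩ | _ <;> simp [BoolExpr.encode] at he
    exact hno ⟨e :: e' :: es, r, by simp [hl], by simp [he]⟩

theorem ParseOutcome.or {c : ℕ} {l : List Bool} {A : List Tok} {S' : Store}
    (h : ParseOutcome S (c + 2) l ((false, true, false) :: A) S') :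
    ParseOutcome S (c + 1) (true :: false :: l) A S' := by
  rcases h with ⟨es, r, hf, rfl⟩ | ⟨hno, h⟩
  · obtain ⟨e, es, rfl, hl, rfl⟩ := hf.cons
    rcases es with _ | ⟨e', es⟩
    · simp at hl
    exact .inl ⟨.or e e' :: es, r, ⟨by simpa using hl, by simp [BoolExpr.encode]⟩,
      by simp [forestToks, XExpr.ofBool, XExpr.toks]⟩
  · refine .inr ⟨?_, h⟩
    rintro ⟨es, r, hf⟩
    obtain ⟨e, es, rfl, hl, he⟩ := hf.cons
    rcases e with _ | _ | _ | ⟨e, e'⟩ <;> simp [BoolExpr.encode] at he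
    exact hno ⟨e :: e' :: es, r, by simp [hl], by simp [he]⟩

theorem ForestOf.var {c : ℕ} {l r : List Bool} {es : List BoolExpr}
    (h : ForestOf (c + 1) (true :: true :: l) es r) :
    ∃ i j r' es', l = unary i ++ (unary j ++ r') ∧ ForestOf c r' es' r := by
  obtain ⟨e, es, rfl, hl, he⟩ := h.cons
  rcases e with ⟨i, j⟩ | _ | _ | _ <;> simp [BoolExpr.encode] at he
  exact ⟨i, j, _, es, he, hl, rfl⟩

theorem ParseOutcome.var {c : ℕ} {l : List Bool} {A : List Tok} {S' : Store} {i j : ℕ}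
    (h : ParseOutcome S c l ((bitToks (unary j)).reverse ++
      ((bitToks (unary i)).reverse ++ (false, true, true) :: A)) S') :
    ParseOutcome S (c + 1) (true :: true :: (unary i ++ (unary j ++ l))) A S' := by
  rcases h with ⟨es, r, ⟨hl, rfl⟩, rfl⟩ | ⟨hno, h⟩
  · exact .inl ⟨.var i j :: es, r, ⟨by simp [hl], by simp [BoolExpr.encode]⟩,
      by simp [forestToks, XExpr.ofBool, XExpr.toks, bitToks]⟩
  · refine .inr ⟨?_, h⟩
    rintro ⟨es, r, hf⟩
    obtain ⟨i', j', r', es', he, hf'⟩ := hf.var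
    obtain ⟨-, he⟩ := unary_append_inj he
    obtain ⟨-, rfl⟩ := unary_append_inj he
    exact hno ⟨es', r, hf'⟩

/-- The height of `val` counts the pending expressions. A successful round consumes at least two
letters, which pays for the round and for the at most one additional expression that it creates;
hence the induction on the input length. -/
theorem exec_parseExprs (hgrd : S.grd = []) (c : ℕ) (l : List Bool)
    (A : List Tok) :
    Exec φ .parseExprs { S with inp := l, val := List.replicate c true, aux := enc A }
      (100 * l.length + 10 * c + 1) (ParseOutcome S c l A) := by
  induction hn : l.length using Nat.strong_induction_on generalizing c l A with
  | _ n ih =>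
  subst hn
  rcases c with _ | c
  · exact Exec.loop_nil rfl (.inl ⟨[], l, ⟨rfl, rfl⟩, by simp [forestToks]⟩)
  -- the parser fails with empty input
  have fail (c' : ℕ) (A' B : List Bool) (l : List Bool) (hB : B ≠ [] ∨ c' ≠ 0)
      (hno : ¬ ∃ es r, ForestOf (c + 1) l es r) : Exec φ .parseExprs
      { S with inp := [], val := List.replicate c' true, aux := A', bad := B } (5 * c' + 1)
      (ParseOutcome S (c + 1) l A) :=
    (exec_parseExprs_nil (S := { S with aux := A' }) c' B).imp fun S' h => .inr ⟨hno, h.1 hB, h.2⟩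
  rcases l with _ | ⟨a, _ | ⟨b, l⟩⟩
  · refine (fail (c + 1) (enc A) S.bad [] (.inr (by omega)) ?_).mono (by omega)
    rintro ⟨es, r, hf⟩
    obtain ⟨e, es, rfl, hl, he⟩ := hf.cons
    exact e.encode_ne_nil (List.append_eq_nil_iff.1 he.symm).1
  · refine Exec.mono (t := 4 + (5 * c + 1) + 1) ?_ (by simp; omega)
    refine Exec.loop_cons (t := 4) (u := 5 * c + 1) (b := true) (l := List.replicate c true) rfl
      (R := (· = { S with inp := [], val := List.replicate c true, aux := enc A
                          bad := true :: S.bad })) ?_ ?_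
    · simp [exec_pop, exec_push, exec_skip, Store.set, Store.get]
    · rintro _ rfl
      refine fail c (enc A) _ [a] (.inl (by simp)) ?_
      rintro ⟨es, r, hf⟩
      obtain ⟨e, es, rfl, hl, he⟩ := hf.cons
      exact e.encode_ne_singleton _ a he.symm
  · have op (c' : ℕ) (t : Tok) (hc : c' ≤ c + 2)
        (h : ∀ S', ParseOutcome S c' l (t :: A) S' →
          ParseOutcome S (c + 1) (a :: b :: l) A S') :
        Exec φ .parseExprs
          { S with inp := l, val := List.replicate c' true, aux := enc (t :: A) }
          (100 * l.length + 10 * c + 21) (ParseOutcome S (c + 1) (a :: b :: l) A) :=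
      ((ih l.length (by simp) c' l (t :: A) rfl).imp h).mono (by omega)
    cases a <;> cases b
    · refine Exec.mono (t := 7 + (100 * l.length + 10 * c + 21) + 1) ?_ (by simp; omega)
      refine Exec.loop_cons (t := 7) (u := 100 * l.length + 10 * c + 21) (b := true)
        (l := List.replicate c true) rfl
        (R := (· = { S with inp := l, val := List.replicate (c + 1) true
                            aux := enc ((false, false, false) :: A) })) ?_ ?_
      · simp [exec_pop, exec_push, exec_skip, exec_pushTok, Store.set, Store.get, enc_cons,
          List.replicate_succ]
      · rintro _ rfl
        exact op _ _ (by omega) fun S' => .neg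
    · refine Exec.mono (t := 8 + (100 * l.length + 10 * c + 21) + 1) ?_ (by simp; omega)
      refine Exec.loop_cons (t := 8) (u := 100 * l.length + 10 * c + 21) (b := true)
        (l := List.replicate c true) rfl
        (R := (· = { S with inp := l, val := List.replicate (c + 2) true
                            aux := enc ((false, false, true) :: A) })) ?_ ?_
      · simp [exec_pop, exec_push, exec_skip, exec_pushTok, Store.set, Store.get, enc_cons,
          List.replicate_succ]
      · rintro _ rfl
        exact op _ _ (by omega) fun S' => .and
    · refine Exec.mono (t := 8 + (100 * l.length + 10 * c + 21) + 1) ?_ (by simp; omega)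
      refine Exec.loop_cons (t := 8) (u := 100 * l.length + 10 * c + 21) (b := true)
        (l := List.replicate c true) rfl
        (R := (· = { S with inp := l, val := List.replicate (c + 2) true
                            aux := enc ((false, true, false) :: A) })) ?_ ?_
      · simp [exec_pop, exec_push, exec_skip, exec_pushTok, Store.set, Store.get, enc_cons,
          List.replicate_succ]
      · rintro _ rfl
        exact op _ _ (by omega) fun S' => .or
    · clear op
      set S₀ : Store := { S with val := List.replicate c true } with hS₀
      have start {x y : ℕ} {R : Store → Prop} (h : Exec φ (.seq (.readUnary .aux Prog.bitCode)
          (.readUnary .aux Prog.bitCode))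
          { S₀ with inp := l, aux := enc ((false, true, true) :: A) } x R)
          (h' : ∀ S', R S' → Exec φ .parseExprs S' y (ParseOutcome S (c + 1) (true :: true :: l) A)) :
          Exec φ .parseExprs { S with inp := true :: true :: l
                                      val := List.replicate (c + 1) true
                                      aux := enc A } ((x + 3 + 1 + 1) + y + 1)
            (ParseOutcome S (c + 1) (true :: true :: l) A) := by
        refine Exec.loop_cons (t := x + 3 + 1 + 1) (u := y) (b := true)
          (l := List.replicate c true) rfl ?_ h'
        rw [exec_pop]
        simp only [Store.get, Store.set, List.head?_cons, List.tail_cons]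
        rw [exec_pop]
        simp only [Store.get, Store.set, List.head?_cons, List.tail_cons]
        rw [exec_pushTok]
        exact h
      rcases eq_unary_append_or l with ⟨i, l, rfl⟩ | ⟨i, rfl⟩
      · rcases eq_unary_append_or l with ⟨j, l, rfl⟩ | ⟨j, rfl⟩
        · refine Exec.mono (t := ((10 * i + 16 + (10 * j + 16)) + 3 + 1 + 1) +
            (100 * l.length + 10 * c + 1) + 1) ?_ (by simp [length_unary]; omega)
          refine start (Exec.seq_eq
            (exec_readUnary_aux (S := S₀) i (unary j ++ l) _ hgrd)
            (exec_readUnary_aux (S := S₀) j l _ hgrd)) ?_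
          rintro _ rfl
          refine (ih l.length (by simp; omega) c l _ rfl).imp fun S' => .var
        · refine Exec.mono (t := ((10 * i + 16 + (10 * j + 16)) + 3 + 1 + 1) + (5 * c + 1) + 1) ?_
            (by simp [length_unary]; omega)
          refine start (Exec.seq_eq
            (exec_readUnary_aux (S := S₀) i (List.replicate j true) _ hgrd)
            (exec_readUnary_aux_fail (S := S₀) j _ hgrd)) ?_
          rintro _ ⟨A', rfl⟩
          refine fail c _ _ _ (.inl (by simp)) ?_
          rintro ⟨es, r, hf⟩
          obtain ⟨i', j', r', es', he, hf'⟩ := hf.var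
          obtain ⟨-, he⟩ := unary_append_inj he
          exact unary_append_ne_replicate _ _ _ he.symm
      -- The first index already exhausts the input; the reader of the second one still runs, on the
      -- empty input, and records a second error.
      · refine Exec.mono (t := ((10 * i + 16 + (10 * 0 + 16)) + 3 + 1 + 1) + (5 * c + 1) + 1) ?_
          (by simp; omega)
        refine start (x := (10 * i + 16) + (10 * 0 + 16)) (R := fun S' => ∃ A',
          S' = { S₀ with inp := [], aux := A', bad := true :: true :: S₀.bad })
          (Exec.seq (t := 10 * i + 16) (u := 10 * 0 + 16)
            (exec_readUnary_aux_fail (S := S₀) i _ hgrd) ?_) ?_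
        · rintro _ ⟨A', rfl⟩
          exact exec_readUnary_aux_fail (S := { S₀ with bad := true :: S₀.bad }) 0 A' hgrd
        · rintro _ ⟨A', rfl⟩
          refine fail c _ _ _ (.inl (by simp)) ?_
          rintro ⟨es, r, hf⟩
          obtain ⟨i', j', r', es', he, hf'⟩ := hf.var
          exact unary_append_ne_replicate _ _ _ he.symm

end PromiseHierarchy

namespace PromiseHierarchy

/-! ### Playing the game with an oracle for first bits -/

/-- The header for `d` additional blocks of size one. -/
def dummies (d : ℕ) : List Bool := (List.replicate d 1).flatMap unary

theorem length_dummies (d : ℕ) : (dummies d).length = 2 * d := by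
  simp [dummies, length_unary]; omega

namespace Prog

/-- Write the expression with reversed tokens on `aux` on top of the query, restoring `body`. -/
def emitBody : Prog Stk := loopTok .aux fun t => pushTok .body t (pushL .qry t.bits skip)

/-- Write the reversed header on `tmp` on top of the query, restoring `hdr`. -/
def emitHdr : Prog Stk := loop .tmp fun b => push .hdr b (push .qry b skip)

/-- Write the query with `d` additional blocks of size one. -/
def buildQuery (d : ℕ) : Prog Stk :=
  seq (moveTok .body .aux) <| seq emitBody <| pushL .qry (dummies d) <|
    seq (move .hdr .tmp) emitHdr

/-- Fix all variables of the first block to optimal values. -/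
def roundsLoop (d : ℕ) : Prog Stk :=
  loop .rnd fun _ => pop .hdr fun o =>
    if o = some true then
      seq (buildQuery d) <| push .qry true <| ask fun b =>
        seq (substPass b) <| seq (moveTok .aux .body) <| push .rnd true skip
    else skip

/-- Determine who wins the game with `k` blocks, the value being left on `val`. -/
def game : ℕ → ℕ → Prog Stk
  | _, 0 => seq (moveTok .body .aux) evalPass
  | d, k + 1 => push .rnd true <| seq (roundsLoop d) <| seq shiftPass <|
      seq (moveTok .aux .body) <| pop .bad fun
        | some _ => push .bad true skip
        | none => pushTok .body (false, false, false) <| seq (game (d + 1) k) <|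
            pop .val fun o => push .val (!o.getD false) skip

end Prog

-- Correctness and running time of the game

variable {φ : PromiseProblem} {S : Store} {u : ℕ} {Q : Store → Prop}

theorem Tok.length_bits_le (t : Tok) : t.bits.length ≤ 12 := by
  obtain ⟨_ | _, _ | _, _ | _⟩ := t <;>
    simp [Tok.bits, XExpr.toBool, BoolExpr.encode, unary]

theorem exec_emitBody (ts B : List Tok) (q : List Bool) :
    Exec φ .emitBody { S with aux := enc ts, body := enc B, qry := q } (19 * ts.length + 1)
      (· = { S with aux := [], body := enc (ts.reverse ++ B)
                    qry := ts.reverse.flatMap Tok.bits ++ q }) := by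
  induction ts generalizing B q with
  | nil => exact .loopTok_nil rfl rfl
  | cons t ts ih =>
    refine Exec.mono (t := (19 * ts.length + 1) + ((1 + t.bits.length + 3) + 3)) ?_
      (by have := t.length_bits_le; simp only [List.length_cons]; omega)
    refine Exec.loopTok_cons (t := t) (l := enc ts) (c := 1 + t.bits.length + 3)
      (u := 19 * ts.length + 1) rfl
      (R := (· = { S with aux := enc ts, body := enc (t :: B), qry := t.bits ++ q })) ?_ ?_
    · rw [exec_pushTok]
      refine Exec.pushL ?_
      simp [exec_skip, Store.set, Store.get, enc_cons]
    · rintro _ rfl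
      refine (ih (t :: B) (t.bits ++ q)).imp ?_
      rintro _ rfl
      simp

theorem exec_emitHdr (h H q : List Bool) :
    Exec φ .emitHdr { S with tmp := h, hdr := H, qry := q } (4 * h.length + 1)
      (· = { S with tmp := [], hdr := h.reverse ++ H, qry := h.reverse ++ q }) := by
  induction h generalizing H q with
  | nil => exact .loop_nil rfl rfl
  | cons b h ih =>
    refine Exec.mono (t := 3 + (4 * h.length + 1) + 1) ?_
      (by simp only [List.length_cons]; omega)
    refine Exec.loop_cons (t := 3) (u := 4 * h.length + 1) (b := b) (l := h) rfl
      (R := (· = { S with tmp := h, hdr := b :: H, qry := b :: q })) ?_ ?_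
    · simp [exec_push, exec_skip, Store.set, Store.get]
    · rintro _ rfl
      refine (ih (b :: H) (b :: q)).imp ?_
      rintro _ rfl
      simp

/-- A stack is filled from the bottom, so the query is written back to front: expression, dummy
blocks, header. Each part is moved away and back, which restores both its order and the original. -/
theorem exec_buildQuery (d : ℕ) (H : List Bool) (ts : List Tok) :
    Exec φ (.buildQuery d) { S with hdr := H, body := enc ts, aux := [], tmp := [], qry := [] }
      (26 * ts.length + 2 * d + 7 * H.length + 4)
      (· = { S with hdr := H, body := enc ts, aux := [], tmp := []
                    qry := H ++ (dummies d ++ ts.flatMap Tok.bits) }) := by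
  refine Exec.mono (t := (7 * ts.length + 1) + ((19 * ts.reverse.length + 1) +
    (((3 * H.length + 1) + (4 * H.reverse.length + 1)) + (dummies d).length))) ?_
    (by simp only [List.length_reverse, length_dummies]; omega)
  refine Exec.seq_eq (Exec.moveTok (by decide) ts [] rfl rfl) ?_
  have h₁ := exec_emitBody (φ := φ) (S := { S with hdr := H, tmp := [] }) ts.reverse [] []
  refine Exec.seq_eq (S' := { S with hdr := H, body := enc ts, aux := [], tmp := []
                                     qry := ts.flatMap Tok.bits }) ?_ ?_
  · simpa [Store.set, enc_nil] using h₁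
  refine Exec.pushL (Exec.seq_eq (Exec.move (by decide) H.length le_rfl) ?_)
  have h₂ := exec_emitHdr (φ := φ) (S := { S with body := enc ts, aux := [] }) H.reverse []
    (dummies d ++ ts.flatMap Tok.bits)
  simpa [Store.set, Store.get] using h₂

/-- One query per letter of the block. That satisfiability is kept needs well-formedness, for
otherwise the queries encode no function; well-formedness itself is unaffected by arbitrary answers
and is therefore claimed unconditionally. -/
theorem exec_roundsLoop {d n N : ℕ} (m : ℕ) {ms : List ℕ} (hms : ∀ m ∈ ms, 1 ≤ m)
    (hn : ms.length + 1 + d = n) (E : XExpr)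
    (hN : E.toks.length + (m + (ms.flatMap unary).length) + d ≤ N) :
    Exec (VAL n) (.roundsLoop d)
      { S with hdr := unary m ++ ms.flatMap unary, body := enc E.toks
               aux := [], tmp := [], qry := [], rnd := [true] }
      ((m + 1) * (100 * (N + 1)))
      fun S' => ∃ E' : XExpr, E'.toks.length ≤ E.toks.length ∧
        (E'.WF (0 :: ms) ↔ E.WF (m :: ms)) ∧
        (E.WF (m :: ms) → (Sat (m :: ms) E.eval ↔ Sat (0 :: ms) E'.eval)) ∧
        S' = { S with hdr := ms.flatMap unary, body := enc E'.toks
                      aux := [], tmp := [], qry := [], rnd := [] } := by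
  induction m generalizing E with
  | zero =>
    refine Exec.mono (t := 2 + (0 + 1) + 1) ?_ (by omega)
    refine Exec.loop_cons (t := 2) (u := 0 + 1) (b := true) (l := []) rfl
      (R := (· = { S with hdr := ms.flatMap unary, body := enc E.toks
                          aux := [], tmp := [], qry := [], rnd := [] })) ?_ ?_
    -- The popped 0 is the end mark of the exhausted block, so what is left on `hdr` is the header
    -- of the remaining blocks.
    · simp [exec_pop, exec_skip, Store.set, Store.get, unary]
    · rintro _ rfl
      exact Exec.loop_nil rfl ⟨E, le_rfl, Iff.rfl, fun _ => Iff.rfl, rfl⟩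
  | succ m ih =>
    set T := E.toks.length with hT
    set H := unary m ++ ms.flatMap unary with hH
    have hHlen : H.length = m + 1 + (ms.flatMap unary).length := by
      rw [hH, List.length_append, length_unary]
    refine Exec.mono (t := ((26 * T + 2 * d + 7 * H.length + 4) +
        (((1 + 20 * T) + ((7 * T + 1) + 2)) + 1 + 1) + 1) + (m + 1) * (100 * (N + 1)) + 1) ?_ ?_
    swap
    · rw [Nat.succ_mul (m + 1)]
      omega
    refine Exec.loop_cons
      (t := (26 * T + 2 * d + 7 * H.length + 4) + (((1 + 20 * T) + ((7 * T + 1) + 2)) + 1 + 1) + 1)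
      (u := (m + 1) * (100 * (N + 1))) (b := true) (l := []) rfl
      (R := fun S' => ∃ b, (E.WF ((m + 1) :: ms) →
          (Sat ((m + 1) :: ms) E.eval ↔ Sat (m :: ms) (E.subst b).eval)) ∧
        S' = { S with hdr := H, body := enc (E.subst b).toks
                      aux := [], tmp := [], qry := [], rnd := [true] }) ?_ ?_
    · rw [exec_pop]
      simp only [Store.get, Store.set, unary_succ, List.cons_append, List.head?_cons, if_true,
        List.tail_cons]
      refine Exec.seq_eq (t := 26 * T + 2 * d + 7 * H.length + 4)
        (exec_buildQuery (S := { S with rnd := [] }) d H E.toks) ?_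
      -- The header has already lost a 1 for the letter about to be fixed; pushing it back makes the
      -- query speak of the block of size `m + 1`.
      rw [exec_push]
      refine Exec.ask ⟨true :: (H ++ (dummies d ++ E.toks.flatMap Tok.bits)), by simp⟩ rfl ?_
      intro b hb
      refine Exec.seq_eq (t := 1 + 20 * T) (u := (7 * T + 1) + 2)
        (S' := { S with hdr := H, body := [], aux := enc (E.subst b).toks.reverse, tmp := []
                        qry := [], rnd := [] }) ?_ ?_
      · have := exec_substPass_loop (φ := VAL n) (u := 0 + 1)
          (S := { S with hdr := H, tmp := [], qry := [], rnd := [] })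
          (Q := (· = { S with hdr := H, body := [], aux := enc (E.subst b).toks.reverse, tmp := []
                              qry := [], rnd := [] })) b E [] []
          (by unfold Prog.substPass Prog.pass; exact Exec.loopTok_nil rfl (by simp [enc_nil]))
        simpa [Store.set, enc_nil] using this
      · have hl := E.length_toks_subst_le b
        refine Exec.seq_eq (t := 7 * T + 1) (u := 2)
          ((Exec.moveTok (by decide) (E.subst b).toks.reverse [] rfl rfl).mono
            (by rw [List.length_reverse]; omega)) ?_
        rw [exec_push, exec_skip]
        refine ⟨b, fun hE => sat_subst_of_mem_VAL hE hms hn ?_ hb, ?_⟩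
        · simp [hH, dummies, unary_succ]
        · simp [Store.set, Store.get]
    · rintro _ ⟨b, hb, rfl⟩
      have hl := E.length_toks_subst_le b
      refine (ih (E.subst b) (by omega)).imp ?_
      rintro S' ⟨E', h₁, h₂, h₃, rfl⟩
      have hwf := XExpr.wf_subst b E m ms
      exact ⟨E', by omega, h₂.trans hwf, fun h => (hb h).trans (h₃ (hwf.2 h)), rfl⟩

/-- The outcome of the game for `E`. -/
def GameOutcome (S : Store) (ms : List ℕ) (E : XExpr) (S' : Store) : Prop :=
  S'.out = S.out ∧
    (E.WF ms → S'.bad = [] ∧ ∃ c, S'.val = [c] ∧ (c = true ↔ Sat ms E.eval)) ∧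
    (¬ E.WF ms → S'.bad ≠ [])

/-- The number of remaining blocks plus the number of dummies stays `n`. Each level has at most `N +
1` rounds of linear cost, hence the quadratic charge. The measure bounded by `N` does not grow: a
level adds a negation token and a dummy block, and removes a block together with the end mark of its
size. -/
theorem exec_game {n N : ℕ} (d k : ℕ) (ms : List ℕ) (hk : ms.length = k)
    (hms : ∀ m ∈ ms, 1 ≤ m) (hn : k + d = n) (E : XExpr)
    (hN : E.toks.length + (ms.flatMap unary).length + d + k ≤ N) :
    Exec (VAL n) (.game d k)
      { S with hdr := ms.flatMap unary, body := enc E.toks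
               aux := [], tmp := [], qry := [], rnd := [], bad := [], val := [] }
      ((k + 1) * (200 * (N + 1) ^ 2)) (GameOutcome S ms E) := by
  have hN2 : N + 1 ≤ (N + 1) ^ 2 := by nlinarith
  induction k generalizing d ms E S with
  | zero =>
    obtain rfl := List.length_eq_zero_iff.1 hk
    refine Exec.mono (t := (7 * E.toks.length + 1) + (1 + 20 * E.toks.length)) ?_ (by omega)
    refine Exec.seq_eq (t := 7 * E.toks.length + 1) (u := 1 + 20 * E.toks.length)
      (Exec.moveTok (by decide) E.toks [] rfl rfl) ?_
    have := exec_evalPass_loop (φ := VAL n) (u := 0 + 1)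
      (S := { S with hdr := [], body := [], tmp := [], qry := [], rnd := [] })
      (Q := GameOutcome S [] E) E [] [] []
      (Exec.loopTok_nil rfl ⟨rfl, fun h => ⟨?_, _, rfl, ?_⟩, fun h => ?_⟩)
    · simpa [Store.set, enc_nil] using this
    · simpa using E.wf_nil.1 h
    · rfl
    · simpa using fun h' => h (E.wf_nil.2 h')
  | succ k ih =>
    obtain ⟨m, ms, rfl⟩ := List.exists_cons_of_length_eq_add_one hk
    have hms' : ∀ m ∈ ms, 1 ≤ m := fun m hm => hms m (List.mem_cons_of_mem _ hm)
    simp only [List.flatMap_cons, List.length_append, length_unary] at hN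
    have hk' : ms.length = k := by simpa using hk
    set T := E.toks.length with hT
    set tail := (k + 1) * (200 * (N + 1) ^ 2) with htail
    refine Exec.mono (t := ((m + 1) * (100 * (N + 1)) +
      ((1 + 20 * T) + ((7 * T + 1) + ((tail + 3) + 3 + 1)))) + 1) ?_ ?_
    swap
    · have : (m + 1) * (100 * (N + 1)) ≤ 100 * (N + 1) ^ 2 := by
        calc (m + 1) * (100 * (N + 1)) ≤ (N + 1) * (100 * (N + 1)) :=
              Nat.mul_le_mul_right _ (by omega)
          _ = _ := by ring
      rw [Nat.succ_mul (k + 1), ← htail]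
      omega
    unfold Prog.game
    rw [exec_push]
    refine Exec.seq (t := (m + 1) * (100 * (N + 1)))
      (exec_roundsLoop (S := { S with bad := [], val := [] }) (N := N) m hms' (by omega) E
        (by omega)) ?_
    rintro _ ⟨E', hl, hwf, hsat, rfl⟩
    refine Exec.seq_eq (t := 1 + 20 * T)
      (S' := { S with hdr := ms.flatMap unary, body := [], aux := enc E'.shiftToks.reverse
                      tmp := [], qry := [], rnd := [], bad := E'.shiftErrors, val := [] }) ?_ ?_
    · have := exec_shiftPass_loop (φ := VAL n) (u := 0 + 1)
        (S := { S with hdr := ms.flatMap unary, tmp := [], qry := [], rnd := [], val := [] })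
        (Q := (· = { S with hdr := ms.flatMap unary, body := [], aux := enc E'.shiftToks.reverse
                            tmp := [], qry := [], rnd := [], bad := E'.shiftErrors, val := [] }))
        E' [] [] [] (by
          unfold Prog.shiftPass Prog.pass
          exact Exec.loopTok_nil rfl (by simp [enc_nil]))
      refine Exec.mono (t := 0 + 1 + 20 * E'.toks.length) ?_ (by omega)
      simpa [Store.set, enc_nil] using this
    have hl' := E'.length_shiftToks_le
    refine Exec.seq_eq (t := 7 * T + 1)
      ((Exec.moveTok (by decide) E'.shiftToks.reverse [] rfl rfl).mono
        (by rw [List.length_reverse]; omega)) ?_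
    rw [exec_pop]
    have hWF := XExpr.wf_zero_cons E' ms
    rcases hs : E'.shiftErrors with _ | ⟨b, B⟩
    · simp only [Store.get, Store.set, List.head?_nil]
      rw [exec_pushTok]
      refine Exec.seq (t := tail) (u := 3) (R := GameOutcome S ms (.neg E'.shift)) ?_ ?_
      · have := ih (S := S) (d + 1) ms hk' hms' (by omega) (.neg E'.shift) (by
          rw [XExpr.toks, ← E'.shiftToks_eq hs, List.length_cons]; omega)
        simpa [Store.set, Store.get, XExpr.toks, E'.shiftToks_eq hs, enc_cons] using this
      · rintro S' ⟨ho, h₁, h₂⟩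
        rw [exec_pop, exec_push, exec_skip]
        -- Without errors in the shift, the verdict on well-formedness can be taken over from the
        -- smaller game.
        have hiff : E.WF (m :: ms) ↔ (XExpr.neg E'.shift).WF ms := by
          rw [← hwf, hWF, hs]; simp [XExpr.WF]
        refine ⟨ho, fun hE => ?_, fun hE => h₂ fun h => hE (hiff.2 h)⟩
        obtain ⟨hb, c, hv, hc⟩ := h₁ (hiff.1 hE)
        refine ⟨hb, !c, by simp [Store.set, Store.get, hv], ?_⟩
        rw [hsat hE, sat_zero_cons, ← hc]
        simp
    · simp only [Store.get, Store.set, List.head?_cons]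
      refine Exec.mono (t := 2) ?_ (by omega)
      rw [exec_push, exec_skip]
      refine ⟨rfl, fun hE => ?_, fun _ => by simp [Store.set]⟩
      -- A recorded error contradicts well-formedness, so stopping early is right.
      have := (hWF.1 (hwf.2 hE)).1
      simp [hs] at this

end PromiseHierarchy

namespace PromiseHierarchy

/-! ### The two reductions -/

theorem weakReduces_of_exec {φ₁ φ₂ : PromiseProblem} (p : Prog Stk) (T : Polynomial ℕ)
    (h : ∀ x : Word, Exec φ₂ p ⟨x.1, [], [], [], [], [], [], [], [], [], []⟩ (T.eval x.1.length)
      fun S => ∃ b ∈ (φ₁ x : Set Bool), S.out = [b]) : WeakReduces φ₁ φ₂ := by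
  refine weakReduces_of_runs .inp .out .qry p T fun x => ?_
  have e : Function.update (fun _ => []) Stk.inp x.1 =
      Store.get ⟨x.1, [], [], [], [], [], [], [], [], [], []⟩ := by
    funext k
    cases k <;> rfl
  rw [e]
  refine Runs.imp (h x) ?_
  rintro _ ⟨S, rfl, hS⟩
  exact hS

theorem XExpr.length_toks_ofBool_le (e : BoolExpr) : (ofBool e).toks.length ≤ e.encode.length := by
  induction e <;> simp_all [ofBool, toks, BoolExpr.encode, length_bitToks] <;> omega

theorem Instance.headerOf {n : ℕ} (I : Instance n) : HeaderOf n I.encode I.sizes I.expr.encode :=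
  ⟨I.length_sizes, I.one_le_sizes, rfl⟩

theorem HeaderOf.unique {n : ℕ} {l r r' : List Bool} {sizes sizes' : List ℕ}
    (h : HeaderOf n l sizes r) (h' : HeaderOf n l sizes' r') : sizes = sizes' ∧ r = r' :=
  flatMap_unary_append_inj (h.1.trans h'.1.symm) (h.2.2.symm.trans h'.2.2)

theorem SAT_eq_true_iff {n : ℕ} {w : Word} :
    SAT n w = true ↔ ∃ I : Instance n, I.encode = w.1 ∧ Sat I.sizes I.fn := by
  simp [SAT]

theorem SAT_encode {n : ℕ} (I : Instance n) (w : Word) (h : I.encode = w.1) :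
    SAT n w = true ↔ Sat I.sizes I.fn := by
  rw [SAT_eq_true_iff]
  refine ⟨?_, fun hI => ⟨I, h, hI⟩⟩
  rintro ⟨J, hJ, hs⟩
  rwa [Instance.encode_injective (h.trans hJ.symm)]

theorem SAT_eq_false {n : ℕ} {w : Word} (h : ∀ I : Instance n, I.encode ≠ w.1) :
    SAT n w = false := by
  rw [← Bool.not_eq_true, SAT_eq_true_iff]
  rintro ⟨I, hI, -⟩
  exact h I hI

theorem VAL_eq_univ {n : ℕ} {w : Word} (h : ∀ I : Instance n, I.encode ≠ w.1) :
    (VAL n w : Set Bool) = Set.univ := by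
  rw [VAL, dif_neg]
  rintro ⟨I, hI⟩
  exact h I hI

/-- The first variable of the first block. -/
def firstVar : BoolExpr := .var 0 0

namespace Prog

/-- Solve `SATₙ` with an oracle for `VALₙ`. -/
def satProg (n : ℕ) : Prog Stk :=
  seq (parseHeader n) <| pop .bad fun
    | some _ => push .out false skip
    | none => seq (move .tmp .hdr) <| push .val true <| seq parseExprs <| pop .bad fun
      | some _ => push .out false skip
      | none => pop .inp fun
        | some _ => push .out false skip
        | none => seq (moveTok .aux .body) <| seq (game 0 n) <| pop .bad fun
          | some _ => push .out false skip
          | none => pop .val fun o => push .out (o.getD false) skip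

/-- Solve `VALₙ` with an oracle for `SATₙ`, by asking for a solution with first letter `1`. -/
def valProg (n : ℕ) : Prog Stk :=
  seq (parseHeader n) <| pop .bad fun
    | some _ => push .out false skip
    | none => pushL .tmp (firstVar.encode.reverse ++ [true, false]) <|
        seq (move .inp .tmp) <| seq (move .tmp .qry) <| ask fun b => push .out b skip

end Prog

/-- A word encodes a function if and only if the header and one expression parse, no letter is left
over, and no variable lies outside its block. The first conditions are tested by the parser, the
last one by the game; a failure of any of them gives the answer 0. -/
theorem exec_satProg (n : ℕ) (x : Word) :
    Exec (VAL n) (.satProg n) ⟨x.1, [], [], [], [], [], [], [], [], [], []⟩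
      (30 * n + 130 * x.1.length + 40 + (n + 1) * (200 * (x.1.length + n + 1) ^ 2))
      (·.out = [SAT n x]) := by
  set L := x.1.length with hL
  set G := (n + 1) * (200 * (L + n + 1) ^ 2) with hG
  have reject {S : Store} (p : Prog Stk) (ho : S.out = []) (hB : S.bad ≠ [])
      (h : ∀ I : Instance n, I.encode ≠ x.1) :
      Exec (VAL n) (.pop .bad fun
        | some _ => .push .out false .skip
        | none => p) S 3 (·.out = [SAT n x]) := by
    obtain ⟨b, B, hb⟩ := List.exists_cons_of_ne_nil hB
    rw [exec_pop]
    simp only [Store.get, hb, List.head?_cons]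
    rw [exec_push, exec_skip, SAT_eq_false h]
    simp [Store.set, Store.get, ho]
  refine Exec.mono (t := (20 * L + 30 * n + 1) + (((3 * L + 1) + ((100 * L + 10 * 1 + 1) +
    (((7 * L + 1) + (G + 4)) + 1 + 1) + 1)) + 1)) ?_ (by omega)
  refine Exec.seq (exec_parseHeader n _ rfl rfl) ?_
  rintro S (⟨sizes, r, hhead, rfl⟩ | ⟨hno, hb, ho⟩)
  swap
  · exact (reject _ ho hb fun I hI => hno ⟨_, _, hI ▸ I.headerOf⟩).mono (by omega)
  replace hhead : HeaderOf n x.1 sizes r := hhead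
  have hlen : L = (sizes.flatMap unary).length + r.length := by
    rw [hL, hhead.2.2, List.length_append]
  rw [exec_pop]
  simp only [Store.get, List.head?_nil, Store.set, List.tail_nil]
  refine Exec.seq_eq (t := 3 * L + 1) (Exec.move (by decide) L
    (by simp only [Store.get, List.append_nil, List.length_reverse]; omega)) ?_
  rw [exec_push]
  have hparse := exec_parseExprs (φ := VAL n)
    (S := ⟨r, [], sizes.flatMap unary, [], [], [], [], [true], [], [], []⟩) rfl 1 r []
  refine Exec.seq (t := 100 * L + 10 * 1 + 1) (R := ParseOutcome
    ⟨r, [], sizes.flatMap unary, [], [], [], [], [true], [], [], []⟩ 1 r []) ?_ ?_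
  · refine Exec.mono (t := 100 * r.length + 10 * 1 + 1) ?_ (by omega)
    simpa [Store.set, Store.get, enc_nil] using hparse
  rintro S (⟨es, r', ⟨hes, rfl⟩, rfl⟩ | ⟨hno, hb, ho⟩)
  swap
  · refine (reject _ ho hb fun I hI => hno ⟨[I.expr], [], rfl, ?_⟩).mono (by omega)
    have := (hhead.unique (hI ▸ I.headerOf)).2
    simpa using this
  obtain ⟨e, rfl⟩ := List.length_eq_one_iff.1 hes
  simp only [List.flatMap_cons, List.flatMap_nil, List.append_nil, List.length_append] at hhead hlen
  rw [exec_pop]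
  simp only [Store.get, List.head?_nil, Store.set, List.tail_nil]
  rw [exec_pop]
  have hexpr (I : Instance n) (hI : I.encode = x.1) :
      I.sizes = sizes ∧ I.expr = e ∧ r' = [] := by
    obtain ⟨h₁, h₂⟩ := hhead.unique (hI ▸ I.headerOf)
    obtain ⟨h₃, h₄⟩ := BoolExpr.encode_append_inj e I.expr (r := r') (s := []) (by simpa using h₂)
    exact ⟨h₁.symm, h₃.symm, h₄⟩
  rcases r' with _ | ⟨a, r'⟩
  swap
  · simp only [Store.get, List.head?_cons]
    refine Exec.mono (t := 2) ?_ (by omega)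
    rw [exec_push, exec_skip, SAT_eq_false fun I hI => by simpa using (hexpr I hI).2.2]
    simp [Store.set, Store.get]
  simp only [Store.get, List.head?_nil, Store.set, List.tail_nil]
  have htoks := XExpr.length_toks_ofBool_le e
  simp only [List.length_nil] at hlen
  refine Exec.seq_eq (t := 7 * L + 1) ((Exec.moveTok (by decide) (XExpr.ofBool e).toks.reverse []
    (by simp [Store.get, forestToks]) rfl).mono (by rw [List.length_reverse]; omega)) ?_
  refine Exec.seq (t := G) (u := 4) (R := GameOutcome ⟨[], [], [], [], [], [], [], [], [], [], []⟩
    sizes (.ofBool e)) ?_ ?_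
  · have := exec_game (n := n) (N := L + n) (S := ⟨[], [], [], [], [], [], [], [], [], [], []⟩) 0 n
      sizes hhead.1 hhead.2.1 rfl (.ofBool e) (by omega)
    simpa [Store.set] using this
  · rintro S ⟨ho, h₁, h₂⟩
    have ho' : S.out = [] := ho
    have hfn : e.eval = (XExpr.ofBool e).eval := funext fun ys => (XExpr.eval_ofBool e ys).symm
    by_cases hw : e.WellFormed sizes
    · obtain ⟨hb, c, hv, hc⟩ := h₁ ((XExpr.wf_ofBool e sizes).2 hw)
      have hS : SAT n x = c := by
        rw [Bool.eq_iff_iff, hc, ← hfn]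
        refine SAT_encode ⟨sizes, e, hhead.1, hhead.2.1, hw⟩ x ?_
        exact (by simp [Instance.encode] : _ = _).trans hhead.2.2.symm
      rw [exec_pop]
      simp only [Store.get, hb, List.head?_nil]
      rw [exec_pop, exec_push, exec_skip, hS]
      simp [Store.set, Store.get, hv, ho']
    · refine (reject _ ho (h₂ fun h => hw ((XExpr.wf_ofBool e sizes).1 h))
        fun I hI => hw ?_).mono (by omega)
      obtain ⟨h₁, h₂, -⟩ := hexpr I hI
      exact h₁ ▸ h₂ ▸ I.wellFormed

theorem weakReduces_SAT_VAL (n : ℕ) : WeakReduces (SAT n).toPromise (VAL n) := by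
  refine weakReduces_of_exec (.satProg n) (30 * Polynomial.C n + 130 * Polynomial.X + 40 +
    (Polynomial.C n + 1) * (200 * (Polynomial.X + Polynomial.C n + 1) ^ 2)) fun x => ?_
  refine Exec.imp (Exec.mono (exec_satProg n x) (by simp)) fun S hS => ⟨SAT n x, rfl, hS⟩

-- VALₙ from SATₙ by one query

theorem not_sat_coSat_false (ms : List ℕ) :
    ¬ Sat ms (fun _ => false) ∧ ¬ CoSat ms (fun _ => false) := by
  induction ms with
  | nil => simp [Sat, CoSat]
  | cons m ms ih =>
    refine ⟨?_, fun h => ih.1 (h (List.replicate m false) (by simp))⟩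
    rintro ⟨x, -, h⟩
    exact ih.2 h

/-- A function, restricted to the words with first letter `1`. -/
def Instance.restrict {n : ℕ} (I : Instance n) (hn : 1 ≤ n) : Instance n where
  sizes := I.sizes
  expr := .and firstVar I.expr
  length_sizes := I.length_sizes
  one_le_sizes := I.one_le_sizes
  wellFormed := by
    refine ⟨?_, I.wellFormed⟩
    obtain ⟨ms, f, hl, h1, hw⟩ := I
    rcases ms with _ | ⟨m, ms⟩
    · simp at hl
      omega
    · exact h1 m (by simp)

/-- A witness for the restriction must start with 1, since otherwise the restricted function is
constantly 0. Conversely, a witness of the function that starts with 1 is one for the restriction;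
so if the restriction is unsatisfiable, any witness starts with 0. -/
theorem Instance.mem_val {n : ℕ} (I : Instance n) (hn : 1 ≤ n) {b : Bool}
    (hb : b = true ↔ Sat (I.restrict hn).sizes (I.restrict hn).fn) : b ∈ (I.val : Set Bool) := by
  by_cases h : n ≠ 0 ∧ Sat I.sizes I.fn
  swap
  · rw [Instance.val, dif_neg h]
    trivial
  rw [Instance.val, dif_pos h]
  change b = true ↔ Sat I.sizes fun ys => firstVar.eval ys && I.fn ys at hb
  change b ∈ firstBits I.sizes I.fn
  have h1 := I.one_le_sizes
  have hl := I.length_sizes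
  replace h := h.2
  generalize I.fn = f at *
  rcases hs : I.sizes with _ | ⟨m, ms⟩
  · rw [hs] at hl
    simp at hl
    omega
  rw [hs] at hb h1 h
  have hm := h1 m (by simp)
  cases b with
  | true =>
    obtain ⟨x, hx, hc⟩ := hb.1 rfl
    rcases x with _ | ⟨a, x⟩
    · simp at hx
      omega
    cases a with
    | false =>
      exact absurd (by simpa [firstVar, BoolExpr.eval] using hc) (not_sat_coSat_false ms).2
    | true =>
      exact ⟨true :: x, ⟨hx, by simpa [firstVar, BoolExpr.eval] using hc⟩, rfl⟩
  | false =>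
    obtain ⟨x, hx, hc⟩ := h
    rcases x with _ | ⟨a, x⟩
    · simp at hx
      omega
    cases a with
    | false => exact ⟨false :: x, ⟨hx, hc⟩, rfl⟩
    | true =>
      refine absurd (hb.2 ⟨true :: x, hx, ?_⟩) (by simp)
      simpa [firstVar, BoolExpr.eval] using hc

/-- Only the header has to be parsed: in prefix notation the conjunction is formed by inserting its
operator and the first variable before the expression. If what follows is no expression, the input
encodes no function and any answer is valid. -/
theorem exec_valProg (n : ℕ) (hn : 1 ≤ n) (x : Word) :
    Exec (SAT n).toPromise (.valProg n) ⟨x.1, [], [], [], [], [], [], [], [], [], []⟩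
      (30 * n + 30 * x.1.length + 40) fun S => ∃ b ∈ (VAL n x : Set Bool), S.out = [b] := by
  set L := x.1.length with hL
  refine Exec.mono (t := (20 * L + 30 * n + 1) +
    ((3 * L + 1 + (3 * (L + 6) + 1 + 3) + (firstVar.encode.reverse ++ [true, false]).length) + 1))
    ?_ (by simp [firstVar, BoolExpr.encode, unary]; omega)
  refine Exec.seq (exec_parseHeader n _ rfl rfl) ?_
  rintro S (⟨sizes, r, hhead, rfl⟩ | ⟨hno, hb, ho⟩)
  swap
  · obtain ⟨b, B, hb⟩ := List.exists_cons_of_ne_nil hb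
    have ho' : S.out = [] := ho
    rw [exec_pop]
    simp only [Store.get, hb, List.head?_cons]
    refine Exec.mono (t := 2) ?_ (by omega)
    rw [exec_push, exec_skip, VAL_eq_univ fun I hI => hno ⟨_, _, hI ▸ I.headerOf⟩]
    exact ⟨false, trivial, by simp [Store.set, Store.get, ho']⟩
  replace hhead : HeaderOf n x.1 sizes r := hhead
  have hlen : L = (sizes.flatMap unary).length + r.length := by
    rw [hL, hhead.2.2, List.length_append]
  rw [exec_pop]
  simp only [Store.get, List.head?_nil, Store.set, List.tail_nil, List.append_nil]
  refine Exec.pushL ?_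
  simp only [Store.get, Store.set]
  refine Exec.seq_eq (t := 3 * L + 1) (Exec.move (by decide) L
    (by simp only [Store.get]; omega)) ?_
  -- Six letters are inserted: two for the operator and four for the variable.
  refine Exec.seq_eq (t := 3 * (L + 6) + 1) (Exec.move (by decide) (L + 6)
    (by simp [Store.get, Store.set, firstVar, BoolExpr.encode, unary] at hlen ⊢; omega)) ?_
  set q := sizes.flatMap unary ++ (false :: true :: (firstVar.encode ++ r)) with hq
  refine Exec.ask ⟨q, by simp [hq]⟩ (by simp [Store.get, Store.set, hq]) fun b hb => ?_
  rw [exec_push, exec_skip]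
  refine ⟨b, ?_, rfl⟩
  by_cases hI : ∃ I : Instance n, I.encode = x.1
  swap
  · rw [VAL_eq_univ fun I h => hI ⟨I, h⟩]
    trivial
  obtain ⟨I, hI⟩ := hI
  rw [VAL_encode I x hI]
  refine I.mem_val hn ?_
  obtain ⟨h₁, h₂⟩ := hhead.unique (hI ▸ I.headerOf)
  have hb' : b = SAT n ⟨q, by simp [hq]⟩ := hb
  rw [hb']
  refine SAT_encode _ _ ?_
  subst h₁ h₂
  rfl

theorem weakReduces_VAL_SAT (n : ℕ) (hn : 1 ≤ n) : WeakReduces (VAL n) (SAT n).toPromise :=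
  weakReduces_of_exec (.valProg n) (30 * Polynomial.C n + 30 * Polynomial.X + 40) fun x =>
    (exec_valProg n hn x).mono (by simp)

theorem VAL_mem_VHat (n : ℕ) : VAL n ∈ VHat n :=
  ⟨id, ⟨Turing.idComputableInPolyTime _⟩, fun _ => subset_rfl⟩

end PromiseHierarchy

open PromiseHierarchy
theorem theorem11 (n : ℕ) (hn : 1 ≤ n) :
    weakClosureOfClass (VHat n) = DeltaHat (n + 1) ∧
      weakClosure (VAL n) = DeltaHat (n + 1) := by
  have h : weakClosure (VAL n) = DeltaHat (n + 1) :=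
    Set.Subset.antisymm (fun _ hφ => hφ.trans (weakReduces_VAL_SAT n hn))
      fun _ hφ => hφ.trans (weakReduces_SAT_VAL n)
  refine ⟨Set.Subset.antisymm ?_ ?_, h⟩
  · rintro φ ⟨ψ, hψ, hφ⟩
    exact (hφ.trans (StrongReduces.weakReduces hψ)).trans (weakReduces_VAL_SAT n hn)
  · exact h ▸ fun φ hφ => ⟨VAL n, VAL_mem_VHat n, hφ⟩
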